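/- Let $0<q<1$, $(x;q)_\infty=\prod_{j\ge 0}(1-xq^j)$, $(x;q)_k=\prod_{j=0}^{k-1}(1-xq^j)$, and put $$E_q(z)=(-(1-q)z;q)_\infty,\qquad e_q(z)=\frac{1}{((1-q)z;q)_\infty},\qquad \varepsilon_q(z)=e_q(z/2)E_q(z/2),$$ $$\mathrm{Sin}_q z=\frac{E_q(iz)-E_q(-iz)}{2i},\qquad \mathrm{Cos}_q z=\frac{E_q(iz)+E_q(-iz)}{2},\qquad \mathrm{Sinh}_q z=\frac{E_q(z)-E_q(-z)}{2}.$$ The positive zeros of $\mathrm{Sin}_q$ are simple and form an infinite sequence $\xi_1<\xi_2<\cdots$ (in increasing order, all of them listed). Let $a>0$, $s\in\mathbb{C}$ and $0<c<\min\{2\xi_1,\frac{1}{a(1-q)}\}$. Let $\Gamma$ be the loop around the negative real axis that comes from $-\infty$ to $-c$ along the upper edge of the cut $(-\infty,0]$ (where $\arg z=\pi$), runs once clockwise around the circle $|z|=c$ (with $\arg z$ going from $\pi$ to $-\pi$), and returns to $-\infty$ along the lower edge of the cut (where $\arg z=-\pi$), and put $$H_q(s,a)=\frac{1}{2\pi i}\int_\Gamma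 z^{s-1}\,\frac{e_q(az)}{\varepsilon_q(z)-1}\,dz .$$ Then this integral converges absolutely, and $$H_q(s,a)=2^{s-1}\sum_{k=1}^{\infty}\Big[(i\xi_k)^{s-1}e_q(2ia\xi_k)+(-i\xi_k)^{s-1}e_q(-2ia\xi_k)\Big]\frac{\mathrm{Cos}_q\,\xi_k}{\mathrm{Sin}_q'\,\xi_k} -\frac{1}{2(q;q)_\infty}\sum_{k=0}^{\infty}\frac{(-1)^k q^{k(k+1)/2}}{(q;q)_k}\left(\frac{q^{-k}}{a(1-q)}\right)^{s}\frac{E_q\!\left(-\frac{q^{-k}}{2a(1-q)}\right)}{\mathrm{Sinh}_q\!\left(\frac{q^{-k}}{2a(1-q)}\right)},$$ where powers are taken with the principal branch (so $\arg(\pm i\xi_k)=\pm\pi/2$), and the series over $i\xi_k$, the series over $-i\xi_k$ and the series over the poles $q^{-k}/(a(1-q))$ each converge absolutely. -/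

import Mathlib

noncomputable section

namespace QHurwitz

/-- The infinite `q`-shifted factorial `(x; q)_∞ = ∏_{k ≥ 0} (1 - x q^k)`. -/
def qInf (q : ℝ) (x : ℂ) : ℂ := ∏' k : ℕ, (1 - x * (q : ℂ) ^ k)

/-- The finite `q`-shifted factorial `(x; q)_n = ∏_{k < n} (1 - x q^k)`. -/
def qFin (q : ℝ) (x : ℂ) (n : ℕ) : ℂ := ∏ k ∈ Finset.range n, (1 - x * (q : ℂ) ^ k)

/-- `E_q(z) = (-(1-q)z; q)_∞`. -/
def bigExp (q : ℝ) (z : ℂ) : ℂ := qInf q (-(1 - (q : ℂ)) * z)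

/-- `e_q(z) = 1 / ((1-q)z; q)_∞`, as a meromorphic function on the plane. -/
def smallExp (q : ℝ) (z : ℂ) : ℂ := 1 / qInf q ((1 - (q : ℂ)) * z)

/-- `ε_q(z) = e_q(z/2) E_q(z/2)`. -/
def epsExp (q : ℝ) (z : ℂ) : ℂ := smallExp q (z / 2) * bigExp q (z / 2)

/-- `Sin_q z = (E_q(iz) - E_q(-iz)) / (2i)`. -/
def qSin (q : ℝ) (z : ℂ) : ℂ :=
  (bigExp q (Complex.I * z) - bigExp q (-(Complex.I * z))) / (2 * Complex.I)

/-- `Cos_q z = (E_q(iz) + E_q(-iz)) / 2`. -/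
def qCos (q : ℝ) (z : ℂ) : ℂ :=
  (bigExp q (Complex.I * z) + bigExp q (-(Complex.I * z))) / 2

/-- `Sinh_q z = (E_q(z) - E_q(-z)) / 2`. -/
def qSinh (q : ℝ) (z : ℂ) : ℂ := (bigExp q z - bigExp q (-z)) / 2

/-- The set of positive zeros of `Sin_q`. -/
def posZeros (q : ℝ) : Set ℝ := {x : ℝ | 0 < x ∧ qSin q (x : ℂ) = 0}

/-- `ξ_k` for `k ≥ 1`: the `k`-th positive zero of `Sin_q` in increasing order, each one being
the least positive zero beyond the previous one (started at `ξ_0 = 0`). -/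
def xi (q : ℝ) : ℕ → ℝ
  | 0 => 0
  | k + 1 => sInf {x : ℝ | x ∈ posZeros q ∧ xi q k < x}

/-- `g(z) = e_q(az) / (ε_q(z) - 1)`. -/
def kern (q a : ℝ) (z : ℂ) : ℂ := smallExp q ((a : ℂ) * z) / (epsExp q z - 1)

/-- The point `z = r e^{iθ}`. -/
def polar (r θ : ℝ) : ℂ := (r : ℂ) * Complex.exp ((θ : ℂ) * Complex.I)

/-- The branch `z^w = r^w e^{iθw}` at `z = r e^{iθ}`, `r > 0`, with the argument `θ` prescribed:
`θ = π` on the upper edge and `θ = -π` on the lower edge of the cut along the negative axis. -/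
def polarPow (r θ : ℝ) (w : ℂ) : ℂ := (r : ℂ) ^ w * Complex.exp ((θ : ℂ) * Complex.I * w)

/-- The integrand `f(z) = z^{s-1} g(z)` at `z = r e^{iθ}`. -/
def integrand (q a : ℝ) (s : ℂ) (r θ : ℝ) : ℂ := polarPow r θ (s - 1) * kern q a (polar r θ)

/-- `∫_Γ F(z) dz`, where `F r θ` is the integrand at `z = r e^{iθ}` and `Γ` is the loop around the
negative real axis that comes in from `-∞` to `-c` along the upper edge of the cut (`θ = π`),
runs clockwise around the circle of radius `c` (`θ` from `π` to `-π`), and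
goes back to `-∞` along the lower edge (`θ = -π`). -/
def loopIntegral (c : ℝ) (F : ℝ → ℝ → ℂ) : ℂ :=
  -(∫ r in Set.Ioi c, F r Real.pi * Complex.exp ((Real.pi : ℂ) * Complex.I))
  + (∫ θ in Real.pi..(-Real.pi), F c θ * (Complex.I * polar c θ))
  + ∫ r in Set.Ioi c, F r (-Real.pi) * Complex.exp (-(Real.pi : ℂ) * Complex.I)

/-- The three pieces of `∫_Γ F(z) dz` converge absolutely. -/
def LoopIntegrable (c : ℝ) (F : ℝ → ℝ → ℂ) : Prop :=
  MeasureTheory.IntegrableOn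
    (fun r => F r Real.pi * Complex.exp ((Real.pi : ℂ) * Complex.I)) (Set.Ioi c)
  ∧ IntervalIntegrable (fun θ => F c θ * (Complex.I * polar c θ))
      MeasureTheory.volume Real.pi (-Real.pi)
  ∧ MeasureTheory.IntegrableOn
    (fun r => F r (-Real.pi) * Complex.exp (-(Real.pi : ℂ) * Complex.I)) (Set.Ioi c)

/-- `H_q(s, a) = (1 / 2πi) ∫_Γ z^{s-1} e_q(az) / (ε_q(z) - 1) dz`, with a circle of radius `c`. -/
def hurwitzH (q c : ℝ) (s : ℂ) (a : ℝ) : ℂ :=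
  1 / (2 * (Real.pi : ℂ) * Complex.I) * loopIntegral c (integrand q a s)

/-- For `w = i` and `w = -i`: the term
`(w ξ_k)^{s-1} e_q(2 w a ξ_k) Cos_q ξ_k / Sin_q' ξ_k`. -/
def zeroTerm (q a : ℝ) (s w : ℂ) (k : ℕ) : ℂ :=
  (w * (xi q k : ℂ)) ^ (s - 1) * smallExp q (2 * w * (a : ℂ) * (xi q k : ℂ))
    * (qCos q (xi q k : ℂ) / deriv (qSin q) (xi q k : ℂ))

/-- The pole `z_k = q^{-k} / (a(1-q))` of `e_q(az)`. -/
def pole (q a : ℝ) (k : ℕ) : ℝ := (q ^ k)⁻¹ / (a * (1 - q))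

/-- The term
`(-1)^k q^{k(k+1)/2} / (q;q)_k * z_k^s * E_q(-z_k/2) / Sinh_q(z_k/2)`, `z_k = q^{-k}/(a(1-q))`. -/
def poleTerm (q a : ℝ) (s : ℂ) (k : ℕ) : ℂ :=
  (-1) ^ k * (q : ℂ) ^ (k * (k + 1) / 2) / qFin q (q : ℂ) k * (pole q a k : ℂ) ^ s
    * (bigExp q (-((pole q a k : ℂ) / 2)) / qSinh q ((pole q a k : ℂ) / 2))

end QHurwitz

end

noncomputable section

namespace QHurwitz

open Complex Filter Topology

/-- The coefficients `(1 - q) q^k` of the product `E_q(z) = ∏ (1 + (1 - q) q^k z)`. -/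
def node (q : ℝ) (k : ℕ) : ℝ := (1 - q) * q ^ k

lemma node_pos {q : ℝ} (hq0 : 0 < q) (hq1 : q < 1) (k : ℕ) : 0 < node q k :=
  mul_pos (by linarith) (pow_pos hq0 k)

lemma hasSum_node {q : ℝ} (hq0 : 0 < q) (hq1 : q < 1) : HasSum (node q) 1 := by
  have h := (hasSum_geometric_of_lt_one hq0.le hq1).mul_left (1 - q)
  rwa [mul_inv_cancel₀ (by linarith)] at h

lemma node_add (q : ℝ) (n k : ℕ) : node q (n + k) = q ^ n * node q k := by
  simp only [node, pow_add]; ring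

lemma bigExp_eq_tprod (q : ℝ) (z : ℂ) : bigExp q z = ∏' k, (1 + (node q k : ℂ) * z) := by
  unfold bigExp qInf node
  congr 1; ext k; push_cast; ring

lemma summable_norm_node_mul {q : ℝ} (hq0 : 0 < q) (hq1 : q < 1) (z : ℂ) :
    Summable fun k => ‖(node q k : ℂ) * z‖ := by
  simp only [norm_mul, norm_real, Real.norm_of_nonneg (node_pos hq0 hq1 _).le]
  exact (hasSum_node hq0 hq1).summable.mul_right _

lemma multipliable_bigExp {q : ℝ} (hq0 : 0 < q) (hq1 : q < 1) (z : ℂ) :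
    Multipliable fun k => 1 + (node q k : ℂ) * z :=
  multipliable_one_add_of_summable (summable_norm_node_mul hq0 hq1 z)

lemma tendsto_bigExp {q : ℝ} (hq0 : 0 < q) (hq1 : q < 1) (z : ℂ) :
    Tendsto (fun N => ∏ k ∈ Finset.range N, (1 + (node q k : ℂ) * z)) atTop (𝓝 (bigExp q z)) := by
  rw [bigExp_eq_tprod]
  exact (multipliable_bigExp hq0 hq1 z).hasProd.tendsto_prod_nat

lemma bigExp_eq_prod_mul {q : ℝ} (hq0 : 0 < q) (hq1 : q < 1) (n : ℕ) (z : ℂ) :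
    bigExp q z = (∏ k ∈ Finset.range n, (1 + (node q k : ℂ) * z)) * bigExp q ((q : ℂ) ^ n * z) := by
  have h1 := (tendsto_bigExp hq0 hq1 ((q : ℂ) ^ n * z)).const_mul
    (∏ k ∈ Finset.range n, (1 + (node q k : ℂ) * z))
  have h2 := (tendsto_bigExp hq0 hq1 z).comp (tendsto_add_atTop_nat n)
  refine tendsto_nhds_unique h2 (h1.congr fun N => ?_)
  simp only [Function.comp]
  rw [add_comm N n, Finset.prod_range_add]
  congr 1
  refine Finset.prod_congr rfl fun k _ => ?_
  rw [node_add]; push_cast; ring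

lemma multipliableLocallyUniformlyOn_bigExp {q : ℝ} (hq0 : 0 < q) (hq1 : q < 1) (R : ℝ) :
    MultipliableLocallyUniformlyOn (fun k z => 1 + (node q k : ℂ) * z) (Metric.ball 0 R) := by
  refine Summable.multipliableLocallyUniformlyOn_nat_one_add (u := fun k => node q k * R)
    Metric.isOpen_ball ((hasSum_node hq0 hq1).summable.mul_right R) ?_ ?_
  · refine .of_forall fun k z hz => ?_
    rw [norm_mul, norm_real, Real.norm_of_nonneg (node_pos hq0 hq1 _).le]
    have : ‖z‖ < R := by simpa using hz
    exact mul_le_mul_of_nonneg_left this.le (node_pos hq0 hq1 _).le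
  · intro k; fun_prop

lemma differentiable_bigExp {q : ℝ} (hq0 : 0 < q) (hq1 : q < 1) : Differentiable ℂ (bigExp q) := by
  intro z
  have hd : DifferentiableOn ℂ (bigExp q) (Metric.ball 0 (‖z‖ + 1)) := by
    have h := (multipliableLocallyUniformlyOn_bigExp hq0 hq1
      (‖z‖ + 1)).hasProdLocallyUniformlyOn
    have h2 := hasProdLocallyUniformlyOn_iff_tendstoLocallyUniformlyOn.1 h
    refine (h2.differentiableOn (.of_forall fun s => ?_) Metric.isOpen_ball).congr
      fun w _ => bigExp_eq_tprod q w
    fun_prop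
  exact hd.differentiableAt (Metric.isOpen_ball.mem_nhds (by simp))

lemma bigExp_eq_zero_iff {q : ℝ} (hq0 : 0 < q) (hq1 : q < 1) (z : ℂ) :
    bigExp q z = 0 ↔ ∃ k, 1 + (node q k : ℂ) * z = 0 := by
  constructor
  · intro h
    by_contra! hne
    rw [bigExp_eq_tprod] at h
    exact tprod_one_add_ne_zero_of_summable hne (summable_norm_node_mul hq0 hq1 z) h
  · rintro ⟨k, hk⟩
    rw [bigExp_eq_prod_mul hq0 hq1 (k + 1), Finset.prod_range_succ, hk]; simp

lemma hasSum_logDeriv_bigExp {q : ℝ} (hq0 : 0 < q) (hq1 : q < 1) {z : ℂ} (hz : bigExp q z ≠ 0)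
    (hre : 0 ≤ z.re) :
    HasSum (fun k => (node q k : ℂ) / (1 + (node q k : ℂ) * z))
      (deriv (bigExp q) z / bigExp q z) := by
  have hne : ∀ k, 1 + (node q k : ℂ) * z ≠ 0 := fun k hk =>
    hz ((bigExp_eq_zero_iff hq0 hq1 z).2 ⟨k, hk⟩)
  have hl : ∀ k, logDeriv (fun w : ℂ => 1 + (node q k : ℂ) * w) z
      = (node q k : ℂ) / (1 + (node q k : ℂ) * z) := by
    intro k
    rw [logDeriv_apply]
    congr 1
    simp
  have hs : Summable fun k => (node q k : ℂ) / (1 + (node q k : ℂ) * z) := by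
    refine Summable.of_norm_bounded (hasSum_node hq0 hq1).summable fun k => ?_
    have ht := node_pos hq0 hq1 k
    rw [norm_div, norm_real, Real.norm_of_nonneg ht.le]
    refine div_le_self ht.le ?_
    refine le_trans ?_ (re_le_norm _)
    simp only [add_re, one_re, mul_re, ofReal_re, ofReal_im, zero_mul, sub_zero]
    nlinarith [mul_nonneg ht.le hre]
  have h := logDeriv_tprod_eq_tsum (Metric.isOpen_ball (x := (0 : ℂ)) (ε := ‖z‖ + 1)) (x := z)
    (by simp) (f := fun k w => 1 + (node q k : ℂ) * w) hne (fun k => by fun_prop)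
    (by simpa only [hl] using hs) (multipliableLocallyUniformlyOn_bigExp hq0 hq1 _)
    (by rwa [← bigExp_eq_tprod])
  simp only [hl, ← bigExp_eq_tprod] at h
  rw [← logDeriv_apply, h]
  exact hs.hasSum

/-! ### Size in the right half plane -/

lemma norm_le_norm_one_add {w : ℂ} (hre : 0 ≤ w.re) : ‖w‖ ≤ ‖1 + w‖ := by
  rw [← sq_le_sq₀ (norm_nonneg _) (norm_nonneg _), ← normSq_eq_norm_sq, ← normSq_eq_norm_sq,
    normSq_apply, normSq_apply]
  simp; nlinarith

lemma one_le_norm_one_add {w : ℂ} (hre : 0 ≤ w.re) : 1 ≤ ‖1 + w‖ := by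
  refine le_trans ?_ (re_le_norm _)
  simpa using hre

lemma norm_one_sub_le_norm_one_add {w : ℂ} (hre : 0 ≤ w.re) : ‖1 - w‖ ≤ ‖1 + w‖ := by
  rw [← sq_le_sq₀ (norm_nonneg _) (norm_nonneg _), ← normSq_eq_norm_sq, ← normSq_eq_norm_sq,
    normSq_apply, normSq_apply]
  simp; nlinarith

lemma node_mul_re {q : ℝ} (k : ℕ) (z : ℂ) : ((node q k : ℂ) * z).re = node q k * z.re := by simp

lemma node_mul_re_nonneg {q : ℝ} (hq0 : 0 < q) (hq1 : q < 1) (k : ℕ) {z : ℂ} (hre : 0 ≤ z.re) :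
    0 ≤ ((node q k : ℂ) * z).re := by
  rw [node_mul_re]; exact mul_nonneg (node_pos hq0 hq1 k).le hre

lemma pow_le_norm_bigExp {q : ℝ} (hq0 : 0 < q) (hq1 : q < 1) (M : ℕ) {z : ℂ} (hre : 0 ≤ z.re) :
    (node q M * ‖z‖) ^ M ≤ ‖bigExp q z‖ := by
  refine ge_of_tendsto (tendsto_bigExp hq0 hq1 z).norm ?_
  filter_upwards [eventually_ge_atTop M] with N hN
  rw [norm_prod, ← Finset.prod_range_mul_prod_Ico _ hN]
  have h1 : (node q M * ‖z‖) ^ M ≤ ∏ k ∈ Finset.range M, ‖1 + (node q k : ℂ) * z‖ := by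
    rw [show (node q M * ‖z‖) ^ M = ∏ _k ∈ Finset.range M, node q M * ‖z‖ by simp]
    refine Finset.prod_le_prod (fun _ _ => mul_nonneg (node_pos hq0 hq1 M).le (norm_nonneg _)) ?_
    intro k hk
    refine le_trans ?_ (norm_le_norm_one_add (node_mul_re_nonneg hq0 hq1 k hre))
    rw [norm_mul, norm_real, Real.norm_of_nonneg (node_pos hq0 hq1 _).le]
    refine mul_le_mul_of_nonneg_right ?_ (norm_nonneg _)
    exact mul_le_mul_of_nonneg_left
      (pow_le_pow_of_le_one hq0.le hq1.le (Finset.mem_range.1 hk).le) (by linarith)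
  have h2 : 1 ≤ ∏ k ∈ Finset.Ico M N, ‖1 + (node q k : ℂ) * z‖ := by
    have := Finset.prod_le_prod (s := Finset.Ico M N) (f := fun _ => (1 : ℝ))
      (g := fun k => ‖1 + (node q k : ℂ) * z‖) (fun _ _ => zero_le_one)
      (fun k _ => one_le_norm_one_add (node_mul_re_nonneg hq0 hq1 k hre))
    simpa using this
  calc _ ≤ _ := h1
    _ ≤ _ := le_mul_of_one_le_right (Finset.prod_nonneg fun _ _ => norm_nonneg _) h2

lemma norm_bigExp_neg_le {q : ℝ} (hq0 : 0 < q) (hq1 : q < 1) {z : ℂ} (hre : 0 ≤ z.re) :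
    ‖bigExp q (-z)‖ ≤ ‖bigExp q z‖ := by
  refine le_of_tendsto_of_tendsto' (tendsto_bigExp hq0 hq1 (-z)).norm
    (tendsto_bigExp hq0 hq1 z).norm fun N => ?_
  rw [norm_prod, norm_prod]
  refine Finset.prod_le_prod (fun _ _ => norm_nonneg _) fun k _ => ?_
  have := norm_one_sub_le_norm_one_add (node_mul_re_nonneg hq0 hq1 k hre)
  rwa [sub_eq_add_neg, ← mul_neg] at this

lemma bigExp_ne_zero_of_re_nonneg {q : ℝ} (hq0 : 0 < q) (hq1 : q < 1) {z : ℂ} (hre : 0 ≤ z.re) :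
    bigExp q z ≠ 0 := by
  rw [Ne, bigExp_eq_zero_iff hq0 hq1]
  rintro ⟨k, hk⟩
  have := one_le_norm_one_add (node_mul_re_nonneg hq0 hq1 k hre)
  rw [hk] at this; norm_num at this

/-- In a sector `Re z ≥ σ |z|` the value `E_q(-z)` is smaller than `E_q(z)` by a factor that is
polynomially far from `1`. -/
lemma norm_bigExp_mul_le_norm_sub {q : ℝ} (hq0 : 0 < q) (hq1 : q < 1) {σ : ℝ} (hσ : 0 ≤ σ) {z : ℂ}
    (hre : σ * ‖z‖ ≤ z.re) :
    ‖bigExp q z‖ * (2 * σ * ((1 - q) * ‖z‖)) ≤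
      ‖bigExp q z - bigExp q (-z)‖ * (1 + (1 - q) * ‖z‖) ^ 2 := by
  have hre0 : 0 ≤ z.re := le_trans (mul_nonneg hσ (norm_nonneg _)) hre
  have hE : ∀ w, bigExp q w = (1 + ((1 - q : ℝ) : ℂ) * w) * bigExp q ((q : ℂ) * w) := by
    intro w
    have := bigExp_eq_prod_mul hq0 hq1 1 w
    simpa [node] using this
  set u : ℂ := ((1 - q : ℝ) : ℂ) * z with hu
  have hq' : (0 : ℝ) < 1 - q := by linarith
  have hun : ‖u‖ = (1 - q) * ‖z‖ := by
    rw [hu, norm_mul, norm_real, Real.norm_of_nonneg hq'.le]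
  have hur : u.re = (1 - q) * z.re := by simp [hu]
  have hus : σ * ‖u‖ ≤ u.re := by
    rw [hun, hur]; nlinarith
  have h1 : bigExp q z = (1 + u) * bigExp q ((q : ℂ) * z) := hE z
  have h2 : bigExp q (-z) = (1 - u) * bigExp q (-((q : ℂ) * z)) := by
    rw [hE (-z)]; congr 2 <;> (simp [hu]; try ring)
  have h3 : ‖bigExp q (-((q : ℂ) * z))‖ ≤ ‖bigExp q ((q : ℂ) * z)‖ :=
    norm_bigExp_neg_le hq0 hq1 (by simp; positivity)
  set G := ‖bigExp q ((q : ℂ) * z)‖ with hG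
  have hG0 : 0 ≤ G := norm_nonneg _
  have h4 : (‖1 + u‖ - ‖1 - u‖) * G ≤ ‖bigExp q z - bigExp q (-z)‖ := by
    refine le_trans ?_ (norm_sub_norm_le _ _)
    rw [h1, h2, norm_mul, norm_mul, sub_mul]
    have := mul_le_mul_of_nonneg_left h3 (norm_nonneg (1 - u))
    linarith
  have hp : ‖1 + u‖ ≤ 1 + ‖u‖ := by simpa using norm_add_le 1 u
  have hm : ‖1 - u‖ ≤ ‖1 + u‖ := norm_one_sub_le_norm_one_add (by rw [hur]; positivity)
  have hd : ‖1 + u‖ ^ 2 - ‖1 - u‖ ^ 2 = 4 * u.re := by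
    rw [← normSq_eq_norm_sq, ← normSq_eq_norm_sq, normSq_apply, normSq_apply]
    simp; ring
  have hp0 : 1 ≤ ‖1 + u‖ := one_le_norm_one_add (by rw [hur]; positivity)
  have hn : ‖bigExp q z‖ = ‖1 + u‖ * G := by rw [h1, norm_mul]
  rw [← hun, hn]
  have key : ‖1 + u‖ * (2 * σ * ‖u‖) ≤ (‖1 + u‖ - ‖1 - u‖) * (1 + ‖u‖) ^ 2 := by
    set P := ‖1 + u‖
    set Q := ‖1 - u‖
    have h5 : 2 * u.re ≤ (P - Q) * P := by nlinarith
    have h6 : P * (2 * u.re) ≤ P * ((P - Q) * P) := mul_le_mul_of_nonneg_left h5 (by linarith)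
    have h7 : (P - Q) * P ^ 2 ≤ (P - Q) * (1 + ‖u‖) ^ 2 :=
      mul_le_mul_of_nonneg_left (pow_le_pow_left₀ (by linarith) hp 2) (by linarith)
    nlinarith
  calc _ = ‖1 + u‖ * (2 * σ * ‖u‖) * G := by ring
    _ ≤ (‖1 + u‖ - ‖1 - u‖) * (1 + ‖u‖) ^ 2 * G := mul_le_mul_of_nonneg_right key hG0
    _ = (‖1 + u‖ - ‖1 - u‖) * G * (1 + ‖u‖) ^ 2 := by ring
    _ ≤ _ := mul_le_mul_of_nonneg_right h4 (by positivity)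

/-! ### The phase of `E_q` on the imaginary axis -/

lemma arctan_le_self {x : ℝ} (hx : 0 ≤ x) : Real.arctan x ≤ x := by
  by_contra! h
  have h1 : 0 < Real.arctan x := lt_of_le_of_lt hx h
  have := Real.lt_tan h1 (Real.arctan_lt_pi_div_two x)
  rw [Real.tan_arctan] at this
  linarith

/-- A continuous argument of `E_q(iy)`. -/
def phase (q y : ℝ) : ℝ := ∑' k, Real.arctan (node q k * y)

lemma summable_phase {q : ℝ} (hq0 : 0 < q) (hq1 : q < 1) {y : ℝ} (hy : 0 ≤ y) :
    Summable fun k => Real.arctan (node q k * y) :=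
  Summable.of_nonneg_of_le (fun k => Real.arctan_nonneg.2 (mul_nonneg (node_pos hq0 hq1 k).le hy))
    (fun k => arctan_le_self (mul_nonneg (node_pos hq0 hq1 k).le hy))
    ((hasSum_node hq0 hq1).summable.mul_right y)

lemma phase_zero (q : ℝ) : phase q 0 = 0 := by simp [phase]

lemma phase_le_self {q : ℝ} (hq0 : 0 < q) (hq1 : q < 1) {y : ℝ} (hy : 0 ≤ y) : phase q y ≤ y := by
  have h := Summable.tsum_le_tsum
    (fun k => arctan_le_self (mul_nonneg (node_pos hq0 hq1 k).le hy))
    (summable_phase hq0 hq1 hy) ((hasSum_node hq0 hq1).summable.mul_right y)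
  rwa [((hasSum_node hq0 hq1).mul_right y).tsum_eq, one_mul] at h

lemma strictMonoOn_phase {q : ℝ} (hq0 : 0 < q) (hq1 : q < 1) :
    StrictMonoOn (phase q) (Set.Ici 0) := by
  intro x hx y hy hxy
  refine Summable.tsum_lt_tsum (i := 0) (fun k => ?_) ?_ (summable_phase hq0 hq1 hx)
    (summable_phase hq0 hq1 hy)
  · exact Real.arctan_strictMono.monotone (mul_le_mul_of_nonneg_left hxy.le (node_pos hq0 hq1 k).le)
  · exact Real.arctan_strictMono (mul_lt_mul_of_pos_left hxy (node_pos hq0 hq1 0))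

lemma continuousOn_phase {q : ℝ} (hq0 : 0 < q) (hq1 : q < 1) (M : ℝ) :
    ContinuousOn (phase q) (Set.Icc 0 M) := by
  refine continuousOn_tsum (u := fun k => node q k * M) (fun k => ?_)
    ((hasSum_node hq0 hq1).summable.mul_right M) fun k y hy => ?_
  · exact (Real.continuous_arctan.comp (continuous_const.mul continuous_id)).continuousOn
  · have hn := (node_pos hq0 hq1 k).le
    rw [Real.norm_of_nonneg (Real.arctan_nonneg.2 (mul_nonneg hn hy.1))]
    exact (arctan_le_self (mul_nonneg hn hy.1)).trans (mul_le_mul_of_nonneg_left hy.2 hn)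

lemma exists_le_phase {q : ℝ} (hq0 : 0 < q) (hq1 : q < 1) (N : ℕ) :
    ∃ y, 0 ≤ y ∧ N * (Real.pi / 4) ≤ phase q y := by
  have hN := node_pos hq0 hq1 N
  refine ⟨(node q N)⁻¹, by positivity, ?_⟩
  have h := (summable_phase hq0 hq1 (inv_nonneg.2 hN.le)).sum_le_tsum (Finset.range N)
    (fun k _ => Real.arctan_nonneg.2 (mul_nonneg (node_pos hq0 hq1 k).le (inv_nonneg.2 hN.le)))
  refine le_trans ?_ h
  rw [show (N : ℝ) * (Real.pi / 4) = ∑ _k ∈ Finset.range N, Real.pi / 4 by simp]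
  refine Finset.sum_le_sum fun k hk => ?_
  rw [← Real.arctan_one]
  refine Real.arctan_strictMono.monotone ?_
  rw [← div_eq_mul_inv, le_div_iff₀ hN, one_mul]
  exact mul_le_mul_of_nonneg_left
    (pow_le_pow_of_le_one hq0.le hq1.le (Finset.mem_range.1 hk).le) (by linarith)

lemma exists_phase_eq {q : ℝ} (hq0 : 0 < q) (hq1 : q < 1) {p : ℝ} (hp : 0 ≤ p) :
    ∃ y, 0 ≤ y ∧ phase q y = p := by
  obtain ⟨N, hN⟩ := exists_nat_ge (p / (Real.pi / 4))
  obtain ⟨M, hM, hM2⟩ := exists_le_phase hq0 hq1 N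
  rw [div_le_iff₀ (by positivity)] at hN
  obtain ⟨y, hy, hy2⟩ := intermediate_value_Icc hM (continuousOn_phase hq0 hq1 M)
    (show p ∈ Set.Icc (phase q 0) (phase q M) from ⟨by rwa [phase_zero], hN.trans hM2⟩)
  exact ⟨y, hy.1, hy2⟩

/-- The inverse of the phase function. -/
def phaseInv (q p : ℝ) : ℝ := sInf {y | 0 ≤ y ∧ phase q y = p}

lemma phaseInv_spec {q : ℝ} (hq0 : 0 < q) (hq1 : q < 1) {p : ℝ} (hp : 0 ≤ p) :
    0 ≤ phaseInv q p ∧ phase q (phaseInv q p) = p := by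
  obtain ⟨y, hy, hy2⟩ := exists_phase_eq hq0 hq1 hp
  have : {y | 0 ≤ y ∧ phase q y = p} = {y} := by
    ext x
    constructor
    · rintro ⟨hx, hx2⟩
      exact (strictMonoOn_phase hq0 hq1).injOn hx hy (hx2.trans hy2.symm)
    · rintro rfl; exact ⟨hy, hy2⟩
  rw [phaseInv, this, csInf_singleton]
  exact ⟨hy, hy2⟩

lemma phaseInv_phase {q : ℝ} (hq0 : 0 < q) (hq1 : q < 1) {y : ℝ} (hy : 0 ≤ y) :
    phaseInv q (phase q y) = y := by
  have hp : 0 ≤ phase q y := by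
    rw [← phase_zero q]
    exact (strictMonoOn_phase hq0 hq1).monotoneOn Set.self_mem_Ici hy hy
  obtain ⟨h1, h2⟩ := phaseInv_spec hq0 hq1 hp
  exact (strictMonoOn_phase hq0 hq1).injOn h1 hy h2

lemma le_phaseInv {q : ℝ} (hq0 : 0 < q) (hq1 : q < 1) {p : ℝ} (hp : 0 ≤ p) : p ≤ phaseInv q p := by
  obtain ⟨h1, h2⟩ := phaseInv_spec hq0 hq1 hp
  exact h2.symm.le.trans (phase_le_self hq0 hq1 h1)

lemma phaseInv_lt {q : ℝ} (hq0 : 0 < q) (hq1 : q < 1) {p p' : ℝ} (hp : 0 ≤ p) (h : p < p') :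
    phaseInv q p < phaseInv q p' := by
  obtain ⟨h1, h2⟩ := phaseInv_spec hq0 hq1 hp
  obtain ⟨h3, h4⟩ := phaseInv_spec hq0 hq1 (hp.trans h.le)
  rw [← (strictMonoOn_phase hq0 hq1).lt_iff_lt h1 h3, h2, h4]
  exact h

lemma one_add_ofReal_mul_I (x : ℝ) :
    1 + (x : ℂ) * I = ‖1 + (x : ℂ) * I‖ * exp (Real.arctan x * I) := by
  have h : 1 + (x : ℂ) * I = (1 : ℝ) + (x : ℝ) * I := by simp
  have h0 : 0 < Real.sqrt (1 + x ^ 2) := by positivity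
  rw [h, norm_add_mul_I, exp_mul_I, ← ofReal_cos, ← ofReal_sin, Real.cos_arctan, Real.sin_arctan]
  have : (Real.sqrt (1 + x ^ 2) : ℂ) ≠ 0 := by exact_mod_cast h0.ne'
  rw [one_pow]
  push_cast
  field_simp

lemma bigExp_mul_I {q : ℝ} (hq0 : 0 < q) (hq1 : q < 1) {y : ℝ} (hy : 0 ≤ y) :
    bigExp q (I * y) = ‖bigExp q (I * y)‖ * exp (phase q y * I) := by
  have h1 := tendsto_bigExp hq0 hq1 (I * y)
  have h2 := (summable_phase hq0 hq1 hy).hasSum.tendsto_sum_nat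
  have h3 : Tendsto (fun N => ((‖∏ k ∈ Finset.range N, (1 + (node q k : ℂ) * (I * y))‖ : ℝ) : ℂ)
      * exp ((∑ k ∈ Finset.range N, Real.arctan (node q k * y) : ℝ) * I)) atTop
      (𝓝 (‖bigExp q (I * y)‖ * exp (phase q y * I))) := by
    refine ((continuous_ofReal.tendsto _).comp h1.norm).mul ?_
    exact ((continuous_exp.comp (continuous_ofReal.mul continuous_const)).tendsto _).comp h2
  refine tendsto_nhds_unique h1 (h3.congr fun N => ?_)
  rw [norm_prod]
  push_cast
  rw [Finset.sum_mul, exp_sum, ← Finset.prod_mul_distrib]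
  refine Finset.prod_congr rfl fun k _ => ?_
  rw [show (node q k : ℂ) * (I * y) = ((node q k * y : ℝ) : ℂ) * I by push_cast; ring]
  have h := (one_add_ofReal_mul_I (node q k * y)).symm
  push_cast at h ⊢
  exact h

lemma bigExp_conj {q : ℝ} (hq0 : 0 < q) (hq1 : q < 1) (z : ℂ) :
    bigExp q (starRingEnd ℂ z) = starRingEnd ℂ (bigExp q z) := by
  have h := (continuous_conj.tendsto _).comp (tendsto_bigExp hq0 hq1 z)
  refine tendsto_nhds_unique (tendsto_bigExp hq0 hq1 _) (h.congr fun N => ?_)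
  simp [map_prod]

lemma bigExp_neg_mul_I {q : ℝ} (hq0 : 0 < q) (hq1 : q < 1) {y : ℝ} (hy : 0 ≤ y) :
    bigExp q (-(I * y)) = ‖bigExp q (I * y)‖ * exp (-(phase q y * I)) := by
  have h := bigExp_conj hq0 hq1 (I * y)
  rw [bigExp_mul_I hq0 hq1 hy] at h
  simp only [map_mul, conj_I, conj_ofReal, ← exp_conj] at h
  rw [neg_mul] at h
  rw [h]; congr 2; ring

lemma qSin_ofReal {q : ℝ} (hq0 : 0 < q) (hq1 : q < 1) {y : ℝ} (hy : 0 ≤ y) :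
    qSin q y = ‖bigExp q (I * y)‖ * Real.sin (phase q y) := by
  rw [qSin, bigExp_neg_mul_I hq0 hq1 hy, bigExp_mul_I hq0 hq1 hy]
  simp only [norm_mul, norm_exp_ofReal_mul_I, mul_one, norm_real, norm_norm]
  rw [ofReal_sin, Complex.sin, ← neg_mul]
  field_simp
  rw [I_sq]; ring

lemma qSin_ofReal_eq_zero_iff {q : ℝ} (hq0 : 0 < q) (hq1 : q < 1) {y : ℝ} (hy : 0 ≤ y) :
    qSin q y = 0 ↔ ∃ n : ℕ, y = phaseInv q (n * Real.pi) := by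
  have h0 : bigExp q (I * y) ≠ 0 := bigExp_ne_zero_of_re_nonneg hq0 hq1 (by simp)
  rw [qSin_ofReal hq0 hq1 hy, mul_eq_zero, or_iff_right (by simpa using h0), ofReal_eq_zero,
    Real.sin_eq_zero_iff]
  constructor
  · rintro ⟨n, hn⟩
    have hp : 0 ≤ phase q y := by
      rw [← phase_zero q]
      exact (strictMonoOn_phase hq0 hq1).monotoneOn Set.self_mem_Ici hy hy
    rw [← hn] at hp
    have hn0 : 0 ≤ n := by
      have := nonneg_of_mul_nonneg_left hp Real.pi_pos
      exact_mod_cast this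
    lift n to ℕ using hn0
    exact ⟨n, by rw [← phaseInv_phase hq0 hq1 hy, ← hn]; simp⟩
  · rintro ⟨n, hn⟩
    refine ⟨n, ?_⟩
    rw [hn, (phaseInv_spec hq0 hq1 (by positivity)).2]; simp

lemma xi_eq_phaseInv {q : ℝ} (hq0 : 0 < q) (hq1 : q < 1) (k : ℕ) :
    xi q k = phaseInv q (k * Real.pi) := by
  induction k with
  | zero =>
    have := phaseInv_phase hq0 hq1 (y := 0) le_rfl
    rw [phase_zero] at this
    simp [xi, this]
  | succ k ih =>
    rw [xi, ih]
    have hmono : ∀ n m : ℕ, phaseInv q (n * Real.pi) < phaseInv q (m * Real.pi) ↔ n < m := by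
      intro n m
      have hm : StrictMono fun n : ℕ => phaseInv q (n * Real.pi) := fun a b hab =>
        phaseInv_lt hq0 hq1 (by positivity)
          (mul_lt_mul_of_pos_right (by exact_mod_cast hab) Real.pi_pos)
      exact hm.lt_iff_lt
    have hnn : ∀ n : ℕ, 0 ≤ phaseInv q (n * Real.pi) := fun n =>
      (phaseInv_spec hq0 hq1 (by positivity)).1
    refine IsLeast.csInf_eq ⟨⟨⟨?_, ?_⟩, ?_⟩, ?_⟩
    · exact (hnn k).trans_lt ((hmono _ _).2 (Nat.lt_succ_self k))
    · exact (qSin_ofReal_eq_zero_iff hq0 hq1 (hnn _)).2 ⟨k + 1, rfl⟩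
    · exact (hmono _ _).2 (Nat.lt_succ_self k)
    · rintro x ⟨⟨hx0, hx1⟩, hx2⟩
      obtain ⟨n, rfl⟩ := (qSin_ofReal_eq_zero_iff hq0 hq1 hx0.le).1 hx1
      rw [hmono] at hx2
      by_contra! hlt
      rw [hmono] at hlt
      omega

lemma strictMono_xi {q : ℝ} (hq0 : 0 < q) (hq1 : q < 1) : StrictMono (xi q) := fun a b hab => by
  rw [xi_eq_phaseInv hq0 hq1, xi_eq_phaseInv hq0 hq1]
  exact phaseInv_lt hq0 hq1 (by positivity)
    (mul_lt_mul_of_pos_right (by exact_mod_cast hab) Real.pi_pos)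

lemma xi_succ_pos {q : ℝ} (hq0 : 0 < q) (hq1 : q < 1) (k : ℕ) : 0 < xi q (k + 1) :=
  strictMono_xi hq0 hq1 (Nat.succ_pos k)

lemma le_xi {q : ℝ} (hq0 : 0 < q) (hq1 : q < 1) (k : ℕ) : (k : ℝ) ≤ xi q k := by
  rw [xi_eq_phaseInv hq0 hq1]
  refine le_trans ?_ (le_phaseInv hq0 hq1 (by positivity))
  nlinarith [Real.pi_gt_three, (Nat.cast_nonneg k : (0 : ℝ) ≤ k)]

lemma range_xi {q : ℝ} (hq0 : 0 < q) (hq1 : q < 1) :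
    Set.range (fun k : ℕ => xi q (k + 1)) = posZeros q := by
  ext x
  constructor
  · rintro ⟨k, rfl⟩
    have h := xi_succ_pos hq0 hq1 k
    exact ⟨h, (qSin_ofReal_eq_zero_iff hq0 hq1 h.le).2 ⟨k + 1, xi_eq_phaseInv hq0 hq1 _⟩⟩
  · rintro ⟨hx0, hx1⟩
    obtain ⟨n, hn⟩ := (qSin_ofReal_eq_zero_iff hq0 hq1 hx0.le).1 hx1
    rw [← xi_eq_phaseInv hq0 hq1] at hn
    cases n with
    | zero => simp [xi] at hn; linarith
    | succ n => exact ⟨n, hn.symm⟩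

lemma qSin_xi {q : ℝ} (hq0 : 0 < q) (hq1 : q < 1) (k : ℕ) : qSin q (xi q (k + 1)) = 0 := by
  have : xi q (k + 1) ∈ posZeros q := by rw [← range_xi hq0 hq1]; exact ⟨k, rfl⟩
  exact this.2

lemma bigExp_eq_of_qSin_eq_zero {q : ℝ} {z : ℂ} (h : qSin q z = 0) :
    bigExp q (-(I * z)) = bigExp q (I * z) := by
  rw [qSin, div_eq_zero_iff, or_iff_left (by simp)] at h
  exact (sub_eq_zero.1 h).symm

lemma qCos_eq_of_qSin_eq_zero {q : ℝ} {z : ℂ} (h : qSin q z = 0) :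
    qCos q z = bigExp q (I * z) := by
  rw [qCos, bigExp_eq_of_qSin_eq_zero h]; ring

lemma hasDerivAt_qSin {q : ℝ} (hq0 : 0 < q) (hq1 : q < 1) (z : ℂ) :
    HasDerivAt (qSin q) ((deriv (bigExp q) (I * z) + deriv (bigExp q) (-(I * z))) / 2) z := by
  have h1 := ((differentiable_bigExp hq0 hq1) (I * z)).hasDerivAt
  have h2 := ((differentiable_bigExp hq0 hq1) (-(I * z))).hasDerivAt
  have h3 : HasDerivAt (fun z => I * z) I z := by simpa using (hasDerivAt_id z).const_mul I
  have h4 := ((h1.comp z h3).sub (h2.comp z h3.neg)).div_const (2 * I)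
  refine h4.congr_deriv ?_
  field_simp
  ring

/-- At a zero of `Sin_q`, `Sin_q' / Cos_q` is bounded below. -/
lemma norm_qCos_le_norm_deriv_qSin {q : ℝ} (hq0 : 0 < q) (hq1 : q < 1) {y : ℝ}
    (h : qSin q y = 0) :
    ‖qCos q y‖ * ((1 - q) / (1 + ((1 - q) * y) ^ 2)) ≤ ‖deriv (qSin q) y‖ := by
  have hE1 : bigExp q (I * y) ≠ 0 := bigExp_ne_zero_of_re_nonneg hq0 hq1 (by simp)
  have hE2 : bigExp q (-(I * y)) ≠ 0 := bigExp_ne_zero_of_re_nonneg hq0 hq1 (by simp)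
  have h1 := (hasSum_logDeriv_bigExp hq0 hq1 hE1 (by simp)).mapL reCLM
  have h2 := (hasSum_logDeriv_bigExp hq0 hq1 hE2 (by simp)).mapL reCLM
  have hd : deriv (qSin q) y = bigExp q (I * y) *
      ((deriv (bigExp q) (I * y) / bigExp q (I * y)
        + deriv (bigExp q) (-(I * y)) / bigExp q (-(I * y))) / 2) := by
    rw [(hasDerivAt_qSin hq0 hq1 _).deriv, bigExp_eq_of_qSin_eq_zero h]
    field_simp
  have hterm : ∀ k, ((node q k : ℂ) / (1 + (node q k : ℂ) * (I * y))).re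
      = node q k / (1 + (node q k * y) ^ 2) := by
    intro k
    rw [div_re]
    simp [normSq_apply]
    ring
  have hterm2 : ∀ k, ((node q k : ℂ) / (1 + (node q k : ℂ) * (-(I * y)))).re
      = node q k / (1 + (node q k * y) ^ 2) := by
    intro k
    rw [div_re]
    simp [normSq_apply]
    ring
  simp only [reCLM_apply, hterm, hterm2] at h1 h2
  have hnn : ∀ k, 0 ≤ node q k / (1 + (node q k * y) ^ 2) := fun k => by
    have := node_pos hq0 hq1 k
    positivity
  have h3 := le_hasSum h1 0 fun k _ => hnn k
  have h4 := le_hasSum h2 0 fun k _ => hnn k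
  rw [hd, norm_mul, qCos_eq_of_qSin_eq_zero h]
  refine mul_le_mul_of_nonneg_left (le_trans ?_ (re_le_norm _)) (norm_nonneg _)
  have hn0 : node q 0 = 1 - q := by simp [node]
  rw [hn0] at h3 h4
  have : ∀ w : ℂ, (w / 2).re = w.re / 2 := fun w => by
    rw [show (2 : ℂ) = ((2 : ℝ) : ℂ) by simp, div_ofReal_re]
  rw [this, add_re]
  linarith

lemma qCos_ne_zero_of_qSin_eq_zero {q : ℝ} (hq0 : 0 < q) (hq1 : q < 1) {y : ℝ}
    (h : qSin q y = 0) : qCos q y ≠ 0 := by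
  rw [qCos_eq_of_qSin_eq_zero h]
  exact bigExp_ne_zero_of_re_nonneg hq0 hq1 (by simp)

lemma deriv_qSin_ne_zero {q : ℝ} (hq0 : 0 < q) (hq1 : q < 1) {y : ℝ}
    (h : qSin q y = 0) : deriv (qSin q) y ≠ 0 := by
  intro h0
  have := norm_qCos_le_norm_deriv_qSin hq0 hq1 h
  rw [h0, norm_zero] at this
  have h2 : 0 < (1 - q) / (1 + ((1 - q) * y) ^ 2) := div_pos (by linarith) (by positivity)
  have h3 := norm_pos_iff.2 (qCos_ne_zero_of_qSin_eq_zero hq0 hq1 h)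
  nlinarith [mul_pos h3 h2]

/-! ### Circles on which the kernel is small -/

lemma sum_div_one_add_sq_le {q : ℝ} (hq0 : 0 < q) (hq1 : q < 1) {T : ℝ} (hT : 0 ≤ T) (N : ℕ) :
    ∑ k ∈ Finset.range N, T * q ^ k / (1 + (T * q ^ k) ^ 2) ≤ 2 / (1 - q) := by
  have hq' : 0 < 1 - q := by linarith
  set g : ℕ → ℝ := fun k => T * q ^ k / (1 + T * q ^ k) with hg
  have hstep : ∀ k, T * q ^ k / (1 + (T * q ^ k) ^ 2) ≤ 2 / (1 - q) * (g k - g (k + 1)) := by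
    intro k
    have hx : 0 ≤ T * q ^ k := by positivity
    have e : T * q ^ (k + 1) = q * (T * q ^ k) := by rw [pow_succ]; ring
    simp only [hg, e]
    generalize T * q ^ k = x at hx
    have h1 : x / (1 + x) - q * x / (1 + q * x) = (1 - q) * x / ((1 + x) * (1 + q * x)) := by
      field_simp; ring
    rw [h1, show 2 / (1 - q) * ((1 - q) * x / ((1 + x) * (1 + q * x)))
      = 2 * x / ((1 + x) * (1 + q * x)) by field_simp, div_le_div_iff₀ (by positivity)
      (by positivity)]
    have h2 : (1 + x) * (1 + q * x) ≤ 2 * (1 + x ^ 2) := by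
      have : q * x ≤ x := by nlinarith
      nlinarith [sq_nonneg (1 - x)]
    nlinarith
  refine (Finset.sum_le_sum fun k _ => hstep k).trans ?_
  rw [← Finset.mul_sum, Finset.sum_range_sub']
  have h0 : g 0 ≤ 1 := by
    simp only [hg, pow_zero, mul_one]
    rw [div_le_one (by positivity)]; linarith
  have h1 : 0 ≤ g N := by simp only [hg]; positivity
  exact mul_le_of_le_one_right (by positivity) (by linarith)

lemma prod_one_add_mul_sub_prod_le {ι : Type*} (s : Finset ι) {A B a : ι → ℂ}
    (h : ∀ i ∈ s, A i = B i * (1 + a i)) :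
    ‖∏ i ∈ s, A i - ∏ i ∈ s, B i‖ ≤ ‖∏ i ∈ s, B i‖ * (Real.exp (∑ i ∈ s, ‖a i‖) - 1) := by
  rw [Finset.prod_congr rfl h, Finset.prod_mul_distrib, ← mul_sub_one, norm_mul]
  exact mul_le_mul_of_nonneg_left (Finset.norm_prod_one_add_sub_one_le _ _) (norm_nonneg _)

/-- Comparison of `E_q(w) / E_q(-w)` with its value at a nearby point `iy` of the imaginary axis. -/
lemma norm_bigExp_mul_sub_le {q : ℝ} (hq0 : 0 < q) (hq1 : q < 1) {h : ℝ} (h0 : 0 ≤ h)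
    (h1 : h ≤ 1 / 2) {y : ℝ} {w : ℂ} (hw : ‖w - I * y‖ ≤ h * |y|) :
    ‖bigExp q w * bigExp q (-(I * y)) - bigExp q (-w) * bigExp q (I * y)‖ ≤
      ‖bigExp q (-w) * bigExp q (I * y)‖ * (Real.exp (8 * h / (1 - q)) - 1) := by
  have hq' : 0 < 1 - q := by linarith
  refine le_of_tendsto_of_tendsto'
    (((tendsto_bigExp hq0 hq1 w).mul (tendsto_bigExp hq0 hq1 _)).sub
      ((tendsto_bigExp hq0 hq1 (-w)).mul (tendsto_bigExp hq0 hq1 _))).norm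
    (((tendsto_bigExp hq0 hq1 (-w)).mul (tendsto_bigExp hq0 hq1 _)).norm.mul_const _) fun N => ?_
  simp only [← Finset.prod_mul_distrib]
  have hs : ∀ k, ‖1 + (node q k : ℂ) * (I * y)‖ ^ 2 = 1 + (node q k * |y|) ^ 2 := by
    intro k
    rw [← normSq_eq_norm_sq, normSq_apply]
    simp [mul_pow]; ring
  have hx : ∀ k, 0 ≤ node q k * |y| := fun k => mul_nonneg (node_pos hq0 hq1 k).le (abs_nonneg y)
  have hs0 : ∀ k, node q k * |y| ≤ ‖1 + (node q k : ℂ) * (I * y)‖ := by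
    intro k
    rw [← sq_le_sq₀ (hx k) (norm_nonneg _), hs]; linarith
  have hs1 : ∀ k, 1 ≤ ‖1 + (node q k : ℂ) * (I * y)‖ := fun k =>
    one_le_norm_one_add (by simp)
  have hs2 : ∀ k, ‖1 + (node q k : ℂ) * (I * y)‖ / 2 ≤ ‖1 + (node q k : ℂ) * -w‖ := by
    intro k
    have e1 : 1 + (node q k : ℂ) * -w
        = (1 + (node q k : ℂ) * -(I * y)) - (node q k : ℂ) * (w - I * y) := by ring
    have e2 : ‖1 + (node q k : ℂ) * -(I * y)‖ = ‖1 + (node q k : ℂ) * (I * y)‖ := by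
      have : 1 + (node q k : ℂ) * -(I * y) = starRingEnd ℂ (1 + (node q k : ℂ) * (I * y)) := by
        simp
      rw [this, RCLike.norm_conj]
    have e3 : ‖(node q k : ℂ) * (w - I * y)‖ ≤ h * (node q k * |y|) := by
      rw [norm_mul, norm_real, Real.norm_of_nonneg (node_pos hq0 hq1 k).le]
      nlinarith [node_pos hq0 hq1 k]
    have e4 := norm_sub_norm_le (1 + (node q k : ℂ) * -(I * y)) ((node q k : ℂ) * (w - I * y))
    rw [e1]
    rw [e2] at e4
    nlinarith [hs0 k, hx k]
  have hne1 : ∀ k, 1 + (node q k : ℂ) * (I * y) ≠ 0 := fun k hk => by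
    have := hs1 k; rw [hk] at this; norm_num at this
  have hne2 : ∀ k, 1 + (node q k : ℂ) * -w ≠ 0 := fun k hk => by
    have := hs1 k; have h2 := hs2 k; rw [hk, norm_zero] at h2; linarith
  refine (prod_one_add_mul_sub_prod_le (Finset.range N)
    (a := fun k => 2 * ((node q k : ℂ) * (w - I * y)) /
      ((1 + (node q k : ℂ) * -w) * (1 + (node q k : ℂ) * (I * y)))) fun k _ => ?_).trans ?_
  · have e : ∀ X A : ℂ, X ≠ 0 → X * (1 + A / X) = X + A := fun X A h => by field_simp
    rw [e _ _ (mul_ne_zero (hne2 k) (hne1 k))]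
    ring
  · refine mul_le_mul_of_nonneg_left (sub_le_sub_right (Real.exp_le_exp.2 ?_) 1) (norm_nonneg _)
    have hb : ∀ k, ‖2 * ((node q k : ℂ) * (w - I * y)) /
      ((1 + (node q k : ℂ) * -w) * (1 + (node q k : ℂ) * (I * y)))‖ ≤
        4 * h * ((1 - q) * |y| * q ^ k / (1 + ((1 - q) * |y| * q ^ k) ^ 2)) := by
      intro k
      have e : (1 - q) * |y| * q ^ k = node q k * |y| := by simp [node]; ring
      rw [e, norm_div, norm_mul, norm_mul, norm_mul, norm_real,
        Real.norm_of_nonneg (node_pos hq0 hq1 k).le, ← hs k, ← mul_div_assoc]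
      have hp : 0 < ‖1 + (node q k : ℂ) * (I * y)‖ := norm_pos_iff.2 (hne1 k)
      have hp2 : 0 < ‖1 + (node q k : ℂ) * -w‖ := norm_pos_iff.2 (hne2 k)
      have hp3 := hs2 k
      rw [div_le_div_iff₀ (by positivity) (by positivity)]
      have f1 : ‖(2 : ℂ)‖ = 2 := by simp
      rw [f1]
      have f2 : node q k * ‖w - I * y‖ ≤ h * (node q k * |y|) := by
        nlinarith [node_pos hq0 hq1 k]
      generalize ‖1 + (node q k : ℂ) * (I * y)‖ = P at *
      generalize ‖1 + (node q k : ℂ) * -w‖ = Q at *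
      have f3 : 2 * (node q k * ‖w - I * y‖) * P ^ 2 ≤ 2 * (h * (node q k * |y|)) * P ^ 2 := by
        gcongr
      have f4 : 2 * (h * (node q k * |y|)) * (P * P) ≤ 2 * (h * (node q k * |y|)) * (2 * Q * P) := by
        have := hx k
        gcongr
        linarith
      nlinarith
    refine (Finset.sum_le_sum fun k _ => hb k).trans ?_
    rw [← Finset.mul_sum]
    have := sum_div_one_add_sq_le hq0 hq1 (T := (1 - q) * |y|) (by positivity) N
    calc _ ≤ 4 * h * (2 / (1 - q)) := by gcongr
      _ = _ := by ring

lemma norm_bigExp_le_near {q : ℝ} (hq0 : 0 < q) (hq1 : q < 1) {y : ℝ}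
    (hy : bigExp q (I * y) + bigExp q (-(I * y)) = 0) {w : ℂ}
    (hw : ‖w - I * y‖ ≤ (1 - q) / 24 * |y|) :
    ‖bigExp q w‖ ≤ ‖bigExp q w - bigExp q (-w)‖ := by
  have hq' : 0 < 1 - q := by linarith
  have h := norm_bigExp_mul_sub_le hq0 hq1 (by linarith) (by linarith) hw
  have hne : 0 < ‖bigExp q (I * y)‖ :=
    norm_pos_iff.2 (bigExp_ne_zero_of_re_nonneg hq0 hq1 (by simp))
  have e : bigExp q (-(I * y)) = -bigExp q (I * y) := eq_neg_of_add_eq_zero_right hy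
  rw [e, show bigExp q w * -bigExp q (I * y) - bigExp q (-w) * bigExp q (I * y)
    = -((bigExp q w + bigExp q (-w)) * bigExp q (I * y)) by ring, norm_neg, norm_mul, norm_mul,
    show 8 * ((1 - q) / 24) / (1 - q) = 1 / 3 by field_simp; norm_num] at h
  have hexp : Real.exp (1 / 3) ≤ 3 / 2 := by
    have h3 : Real.exp (1 / 3) ^ 3 = Real.exp 1 := by rw [← Real.exp_nat_mul]; norm_num
    have := Real.exp_one_lt_d9
    by_contra! hlt
    have := pow_lt_pow_left₀ hlt (by norm_num) (n := 3) (by norm_num)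
    rw [h3] at this
    norm_num at this
    linarith
  have h2 : ‖bigExp q w + bigExp q (-w)‖ ≤ ‖bigExp q (-w)‖ * (1 / 2) := by
    have : ‖bigExp q w + bigExp q (-w)‖ * ‖bigExp q (I * y)‖
        ≤ ‖bigExp q (-w)‖ * (1 / 2) * ‖bigExp q (I * y)‖ := by
      refine h.trans ?_
      have : 0 ≤ ‖bigExp q (-w)‖ * ‖bigExp q (I * y)‖ := by positivity
      nlinarith
    exact le_of_mul_le_mul_right this hne
  have h3 : ‖bigExp q w‖ ≤ ‖bigExp q (-w)‖ * (3 / 2) := by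
    have := norm_sub_le (bigExp q w + bigExp q (-w)) (bigExp q (-w))
    rw [add_sub_cancel_right] at this
    linarith
  have h4 : ‖bigExp q (-w)‖ * (3 / 2) ≤ ‖bigExp q w - bigExp q (-w)‖ := by
    have := norm_sub_norm_le (2 * bigExp q (-w)) (bigExp q w + bigExp q (-w))
    rw [show 2 * bigExp q (-w) - (bigExp q w + bigExp q (-w))
      = -(bigExp q w - bigExp q (-w)) by ring, norm_neg, norm_mul] at this
    simp only [norm_ofNat] at this
    linarith
  exact h3.trans h4

lemma norm_bigExp_le_sector {q : ℝ} (hq0 : 0 < q) (hq1 : q < 1) {σ : ℝ} (hσ : 0 < σ) {w : ℂ}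
    (hw0 : w ≠ 0) (hre : σ * ‖w‖ ≤ |w.re|) :
    ‖bigExp q w‖ ≤ (1 + ‖w‖) ^ 2 / (2 * σ * (1 - q) * ‖w‖) * ‖bigExp q w - bigExp q (-w)‖ := by
  have hq' : 0 < 1 - q := by linarith
  have hw : 0 < ‖w‖ := norm_pos_iff.2 hw0
  have main : ∀ v : ℂ, ‖v‖ = ‖w‖ → σ * ‖v‖ ≤ v.re → ‖bigExp q v‖ ≤
      (1 + ‖w‖) ^ 2 / (2 * σ * (1 - q) * ‖w‖) * ‖bigExp q v - bigExp q (-v)‖ := by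
    intro v hv hv2
    have h := norm_bigExp_mul_le_norm_sub hq0 hq1 hσ.le hv2
    rw [div_mul_eq_mul_div, le_div_iff₀ (by positivity), ← hv]
    have h2 : (1 + (1 - q) * ‖v‖) ^ 2 ≤ (1 + ‖v‖) ^ 2 := by
      gcongr
      nlinarith [norm_nonneg v]
    nlinarith [mul_le_mul_of_nonneg_left h2 (norm_nonneg (bigExp q v - bigExp q (-v)))]
  rcases le_abs.1 hre with h | h
  · exact main w rfl h
  · have := main (-w) (norm_neg w) (by simpa using h)
    rw [neg_neg, norm_sub_rev] at this
    refine le_trans ?_ this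
    have h3 := norm_bigExp_neg_le hq0 hq1 (z := -w) (by
      have := mul_nonneg hσ.le hw.le
      simp; linarith)
    rwa [neg_neg] at h3

lemma norm_bigExp_le_on_circle {q : ℝ} (hq0 : 0 < q) (hq1 : q < 1) {y : ℝ} (hy1 : 1 ≤ y)
    (hy : bigExp q (I * y) + bigExp q (-(I * y)) = 0) {w : ℂ} (hw1 : y ≤ ‖w‖)
    (hw2 : ‖w‖ ≤ (1 + (1 - q) / 96) * y) :
    ‖bigExp q w‖ ≤ 96 / (1 - q) ^ 2 * (1 + ‖w‖) ^ 2 * ‖bigExp q w - bigExp q (-w)‖ := by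
  have hq' : 0 < 1 - q := by linarith
  have hw0 : 0 < ‖w‖ := by linarith
  by_cases hre : (1 - q) / 192 * ‖w‖ ≤ |w.re|
  · refine (norm_bigExp_le_sector hq0 hq1 (by positivity) (norm_pos_iff.1 hw0) hre).trans ?_
    refine mul_le_mul_of_nonneg_right ?_ (norm_nonneg _)
    rw [div_mul_eq_mul_div, div_le_div_iff₀ (by positivity) (by positivity)]
    have : (1 + ‖w‖) ^ 2 * (1 - q) ^ 2 * 1 ≤ (1 + ‖w‖) ^ 2 * (1 - q) ^ 2 * ‖w‖ := by
      gcongr; linarith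
    nlinarith
  · push Not at hre
    have him := abs_im_le_norm w
    have him2 := norm_le_abs_re_add_abs_im w
    have hA : |w.re| + |(|w.im| - y)| ≤ (1 - q) / 24 * y := by
      have : |(|w.im| - y)| ≤ (1 - q) / 48 * y := by
        rw [abs_le]; constructor <;> nlinarith
      nlinarith
    have hone : ‖bigExp q w‖ ≤ ‖bigExp q w - bigExp q (-w)‖ := by
      rcases le_total 0 w.im with hs | hs
      · refine norm_bigExp_le_near hq0 hq1 hy ?_
        rw [abs_of_nonneg (by linarith : 0 ≤ y)]
        refine le_trans (norm_le_abs_re_add_abs_im _) ?_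
        rw [abs_of_nonneg hs] at hA
        simpa using hA
      · refine norm_bigExp_le_near hq0 hq1 (y := -y) (by
          push_cast; rw [mul_neg, neg_neg, add_comm]; exact hy) ?_
        rw [abs_neg, abs_of_nonneg (by linarith : 0 ≤ y)]
        refine le_trans (norm_le_abs_re_add_abs_im _) ?_
        rw [abs_of_nonpos hs, ← abs_neg (-w.im - y)] at hA
        simpa [add_comm] using hA
    refine hone.trans (le_mul_of_one_le_left (norm_nonneg _) ?_)
    rw [div_mul_eq_mul_div, le_div_iff₀ (by positivity)]
    have h1 : (1 - q) ^ 2 ≤ 1 := by nlinarith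
    nlinarith [sq_nonneg ‖w‖]

lemma bigExp_add_eq_zero_phaseInv {q : ℝ} (hq0 : 0 < q) (hq1 : q < 1) (n : ℕ) :
    bigExp q (I * phaseInv q (n * Real.pi + Real.pi / 2))
      + bigExp q (-(I * phaseInv q (n * Real.pi + Real.pi / 2))) = 0 := by
  have hp : 0 ≤ n * Real.pi + Real.pi / 2 := by positivity
  obtain ⟨h1, h2⟩ := phaseInv_spec hq0 hq1 hp
  rw [bigExp_neg_mul_I hq0 hq1 h1, bigExp_mul_I hq0 hq1 h1, h2]
  simp only [norm_mul, norm_exp_ofReal_mul_I, mul_one, norm_real, norm_norm]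
  rw [← mul_add, ← neg_mul]
  have : exp ((n * Real.pi + Real.pi / 2 : ℝ) * I) + exp (-((n * Real.pi + Real.pi / 2 : ℝ) : ℂ) * I)
      = 2 * Complex.cos ((n * Real.pi + Real.pi / 2 : ℝ) : ℂ) := by
    rw [Complex.cos]; ring
  rw [this, ← ofReal_cos, Real.cos_add_pi_div_two, Real.sin_nat_mul_pi]; simp

/-- Of two radii in the ratio `1 + (1 - q) / 96`, one stays away from the geometric progression
`q^{-k} / b`. -/
lemma abs_one_sub_or {q : ℝ} (hq0 : 0 < q) (hq1 : q < 1) (x : ℝ) :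
    (∀ k : ℕ, (1 - q) / 400 ≤ |1 - x * q ^ k|) ∨
      ∀ k : ℕ, (1 - q) / 400 ≤ |1 - (1 + (1 - q) / 96) * x * q ^ k| := by
  by_contra! hcon
  obtain ⟨⟨k, hk⟩, j, hj⟩ := hcon
  rw [abs_lt] at hk hj
  have hq' : 0 < 1 - q := by linarith
  rcases le_or_gt j k with hjk | hjk
  · obtain ⟨m, rfl⟩ := Nat.exists_eq_add_of_le hjk
    rw [pow_add] at hk
    have h1 : q ^ m ≤ 1 := pow_le_one₀ hq0.le hq1.le
    have hx : 0 < x * q ^ j := by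
      by_contra! hneg
      nlinarith [mul_nonneg (by linarith : 0 ≤ 1 + (1 - q) / 96) (neg_nonneg.2 hneg)]
    generalize x * q ^ j = X at *
    have h2 : X * q ^ m ≤ X := by nlinarith
    nlinarith
  · obtain ⟨m, rfl⟩ := Nat.exists_eq_add_of_lt hjk
    rw [show k + m + 1 = k + (m + 1) by ring, pow_add, pow_succ] at hj
    have h1 : q ^ m ≤ 1 := pow_le_one₀ hq0.le hq1.le
    have h0 : 0 ≤ q ^ m := by positivity
    have hx : 0 < x * q ^ k := by linarith
    have e : (1 + (1 - q) / 96) * x * (q ^ k * (q ^ m * q))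
      = (1 + (1 - q) / 96) * (x * q ^ k) * (q ^ m * q) := by ring
    rw [e] at hj
    generalize x * q ^ k = X at *
    have h2 : q ^ m * q ≤ q := by nlinarith
    have h3 : (1 + (1 - q) / 96) * X * (q ^ m * q) ≤ (1 + (1 - q) / 96) * X * q := by gcongr
    have h4 : (1 + (1 - q) / 96) * X * q ≤ (1 + (1 - q) / 96) * (1 + (1 - q) / 400) * q := by
      gcongr; linarith
    nlinarith [mul_pos hq' hq', mul_pos (mul_pos hq' hq') hq']

lemma exists_le_prod_one_sub_pow {q : ℝ} (hq0 : 0 < q) (hq1 : q < 1) :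
    ∃ G, 0 < G ∧ ∀ N, G ≤ ∏ j ∈ Finset.range N, (1 - q ^ (j + 1)) := by
  have hq' : 0 < 1 - q := by linarith
  have hlt : ∀ j, q ^ (j + 1) < 1 := fun j => pow_lt_one₀ hq0.le hq1 (by omega)
  have hqc : (1 - (q : ℂ)) ≠ 0 := by
    have : ((1 - q : ℝ) : ℂ) ≠ 0 := by exact_mod_cast hq'.ne'
    simpa using this
  have hfac : ∀ j, 1 + (node q j : ℂ) * (-q / (1 - q)) = ((1 - q ^ (j + 1) : ℝ) : ℂ) := by
    intro j
    simp only [node]; push_cast; field_simp; ring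
  have ht := (tendsto_bigExp hq0 hq1 (-q / (1 - q))).norm
  have e : ∀ N, ‖∏ k ∈ Finset.range N, (1 + (node q k : ℂ) * (-q / (1 - q)))‖
      = ∏ j ∈ Finset.range N, (1 - q ^ (j + 1)) := by
    intro N
    rw [norm_prod]
    refine Finset.prod_congr rfl fun j _ => ?_
    rw [hfac, norm_real, Real.norm_of_nonneg (by linarith [hlt j])]
  simp only [e] at ht
  refine ⟨_, norm_pos_iff.2 ?_, fun N => Antitone.le_of_tendsto ?_ ht N⟩
  · rw [Ne, bigExp_eq_zero_iff hq0 hq1]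
    rintro ⟨k, hk⟩
    rw [hfac, ofReal_eq_zero] at hk
    linarith [hlt k]
  · refine antitone_nat_of_succ_le fun n => ?_
    rw [Finset.prod_range_succ]
    refine mul_le_of_le_one_right (Finset.prod_nonneg fun j _ => by linarith [hlt j]) ?_
    have : 0 < q ^ (n + 1) := by positivity
    linarith

lemma le_prod_abs_one_sub {q : ℝ} (hq0 : 0 < q) (hq1 : q < 1) {G : ℝ} (hG0 : 0 < G)
    (hG : ∀ N, G ≤ ∏ j ∈ Finset.range N, (1 - q ^ (j + 1))) {δ x : ℝ} (hδ : 0 ≤ δ) {M : ℕ}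
    (hx : 1 ≤ x * q ^ M) (hxδ : ∀ k : ℕ, δ ≤ |1 - x * q ^ k|) :
    ∀ᶠ N in atTop, (x * q ^ M) ^ M * G * (δ * δ) * G ≤
      ∏ k ∈ Finset.range N, |1 - x * q ^ k| := by
  have hx0 : 0 < x := by
    by_contra! h
    nlinarith [pow_pos hq0 M]
  have hex : ∃ n, x * q ^ n < 1 := by
    have : Tendsto (fun n => x * q ^ n) atTop (𝓝 (x * 0)) :=
      (tendsto_pow_atTop_nhds_zero_of_lt_one hq0.le hq1).const_mul x
    rw [mul_zero] at this
    exact (this.eventually (gt_mem_nhds one_pos)).exists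
  have hanti : ∀ {i j : ℕ}, i ≤ j → x * q ^ j ≤ x * q ^ i := fun h =>
    mul_le_mul_of_nonneg_left (pow_le_pow_of_le_one hq0.le hq1.le h) hx0.le
  classical
  obtain ⟨n, hn⟩ : ∃ n, Nat.find hex = n + 1 := by
    refine Nat.exists_eq_succ_of_ne_zero fun h => ?_
    have h1 := Nat.find_spec hex
    rw [h] at h1
    linarith [hanti (Nat.zero_le M)]
  have hn1 : x * q ^ (n + 1) < 1 := hn ▸ Nat.find_spec hex
  have hn0 : 1 ≤ x * q ^ n := not_lt.1 (Nat.find_min hex (by omega))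
  have hMn : M ≤ n := by
    by_contra! h
    linarith [hanti (show n + 1 ≤ M by omega)]
  filter_upwards [eventually_ge_atTop (n + 2)] with N hN
  obtain ⟨L, rfl⟩ := Nat.exists_eq_add_of_le hN
  rw [Finset.prod_range_add, Finset.prod_range_succ, Finset.prod_range_succ]
  have hlt : ∀ j, 0 ≤ 1 - q ^ (j + 1) := fun j => by
    have := pow_lt_one₀ hq0.le hq1 (n := j + 1) (by omega)
    linarith
  have h1 : (x * q ^ M) ^ M * G ≤ ∏ k ∈ Finset.range n, |1 - x * q ^ k| := by
    have hfac : ∀ k ∈ Finset.range n, x * q ^ k * (1 - q ^ (n - 1 - k + 1)) ≤ |1 - x * q ^ k| := by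
      intro k hk
      have hk' := Finset.mem_range.1 hk
      have e : q ^ k * q ^ (n - 1 - k + 1) = q ^ n := by
        rw [← pow_add]; congr 1; omega
      have : x * q ^ k * (1 - q ^ (n - 1 - k + 1)) = x * q ^ k - x * q ^ n := by
        rw [← e]; ring
      rw [this]
      refine le_trans ?_ (neg_le_abs _)
      linarith
    refine le_trans ?_ (Finset.prod_le_prod (fun k _ => mul_nonneg (by positivity) (hlt _)) hfac)
    rw [Finset.prod_mul_distrib, Finset.prod_range_reflect (fun j => 1 - q ^ (j + 1)) n]
    refine mul_le_mul ?_ (hG n) hG0.le (Finset.prod_nonneg fun _ _ => by positivity)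
    rw [← Finset.prod_range_mul_prod_Ico _ hMn]
    have h2 : (x * q ^ M) ^ M ≤ ∏ k ∈ Finset.range M, x * q ^ k := by
      rw [show (x * q ^ M) ^ M = ∏ _k ∈ Finset.range M, x * q ^ M by simp]
      exact Finset.prod_le_prod (fun _ _ => by positivity) fun k hk =>
        hanti (Finset.mem_range.1 hk).le
    have h3 : 1 ≤ ∏ k ∈ Finset.Ico M n, x * q ^ k := by
      have := Finset.prod_le_prod (s := Finset.Ico M n) (f := fun _ => (1 : ℝ))
        (g := fun k => x * q ^ k) (fun _ _ => zero_le_one)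
        (fun k hk => hn0.trans (hanti (Finset.mem_Ico.1 hk).2.le))
      simpa using this
    exact h2.trans (le_mul_of_one_le_right (Finset.prod_nonneg fun _ _ => by positivity) h3)
  have h4 : G ≤ ∏ j ∈ Finset.range L, |1 - x * q ^ (n + 2 + j)| := by
    refine (hG L).trans (Finset.prod_le_prod (fun j _ => hlt j) fun j _ => ?_)
    refine le_trans ?_ (le_abs_self _)
    have e : x * q ^ (n + 2 + j) = x * q ^ (n + 1) * q ^ (j + 1) := by
      rw [mul_assoc, ← pow_add]; congr 2; ring
    rw [e]
    nlinarith [pow_pos hq0 (j + 1)]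
  have h5 := mul_le_mul (hxδ n) (hxδ (n + 1)) hδ (abs_nonneg _)
  rw [mul_assoc (∏ k ∈ Finset.range n, |1 - x * q ^ k|)]
  gcongr

lemma le_norm_bigExp_neg {q : ℝ} (hq0 : 0 < q) (hq1 : q < 1) {G : ℝ} (hG0 : 0 < G)
    (hG : ∀ N, G ≤ ∏ j ∈ Finset.range N, (1 - q ^ (j + 1))) {δ x : ℝ} (hδ : 0 ≤ δ) {M : ℕ}
    (hx : 1 ≤ x * q ^ M) (hxδ : ∀ k : ℕ, δ ≤ |1 - x * q ^ k|) {w : ℂ} (hw : (1 - q) * ‖w‖ = x) :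
    (x * q ^ M) ^ M * G * (δ * δ) * G ≤ ‖bigExp q (-w)‖ := by
  refine ge_of_tendsto (tendsto_bigExp hq0 hq1 (-w)).norm ?_
  filter_upwards [le_prod_abs_one_sub hq0 hq1 hG0 hG hδ hx hxδ] with N hN
  refine hN.trans ?_
  rw [norm_prod]
  refine Finset.prod_le_prod (fun _ _ => abs_nonneg _) fun k _ => ?_
  have := abs_norm_sub_norm_le (1 : ℂ) ((node q k : ℂ) * w)
  rw [norm_one, norm_mul, norm_real, Real.norm_of_nonneg (node_pos hq0 hq1 k).le] at this
  rw [mul_neg, ← sub_eq_add_neg]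
  refine le_trans (le_of_eq ?_) this
  rw [← hw, node]; congr 1; ring

/-! ### Residues in the strip `|Im ζ| ≤ π` -/

/-- The integral of `f` over the boundary of the rectangle `[l, r] × [-π, π]`. -/
def stripBoundary (f : ℂ → ℂ) (l r : ℝ) : ℂ :=
  (∫ x : ℝ in l..r, f (x + (-Real.pi : ℝ) * I)) - (∫ x : ℝ in l..r, f (x + (Real.pi : ℝ) * I))
    + I * (∫ y : ℝ in (-Real.pi)..Real.pi, f (r + y * I))
    - I * ∫ y : ℝ in (-Real.pi)..Real.pi, f (l + y * I)

/-- The closed rectangle `[l, r] × [-π, π]`. -/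
def strip (l r : ℝ) : Set ℂ := {ζ | ζ.re ∈ Set.Icc l r ∧ ζ.im ∈ Set.Icc (-Real.pi) Real.pi}

/-- The boundary of the rectangle `[l, r] × [-π, π]`. -/
def stripEdge (l r : ℝ) : Set ℂ :=
  {ζ | ζ ∈ strip l r ∧ (ζ.re = l ∨ ζ.re = r ∨ ζ.im = -Real.pi ∨ ζ.im = Real.pi)}

lemma neg_pi_le_pi : -Real.pi ≤ Real.pi := by linarith [Real.pi_pos]

lemma edge_bottom_mem {l r x : ℝ} (hx : x ∈ Set.Icc l r) :
    (x + (-Real.pi : ℝ) * I : ℂ) ∈ stripEdge l r := by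
  simp [stripEdge, strip, hx.1, hx.2, Real.pi_pos.le]

lemma edge_top_mem {l r x : ℝ} (hx : x ∈ Set.Icc l r) :
    (x + (Real.pi : ℝ) * I : ℂ) ∈ stripEdge l r := by
  simp [stripEdge, strip, hx.1, hx.2, Real.pi_pos.le]

lemma edge_right_mem {l r y : ℝ} (hlr : l ≤ r) (hy : y ∈ Set.Icc (-Real.pi) Real.pi) :
    (r + y * I : ℂ) ∈ stripEdge l r := by
  simp [stripEdge, strip, hlr, hy.1, hy.2]

lemma edge_left_mem {l r y : ℝ} (hlr : l ≤ r) (hy : y ∈ Set.Icc (-Real.pi) Real.pi) :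
    (l + y * I : ℂ) ∈ stripEdge l r := by
  simp [stripEdge, strip, hlr, hy.1, hy.2]

lemma stripBoundary_congr {f g : ℂ → ℂ} {l r : ℝ} (hlr : l ≤ r) (h : Set.EqOn f g (stripEdge l r)) :
    stripBoundary f l r = stripBoundary g l r := by
  unfold stripBoundary
  congr 1; congr 1; congr 1
  · refine intervalIntegral.integral_congr fun x hx => h (edge_bottom_mem ?_)
    rwa [Set.uIcc_of_le hlr] at hx
  · refine intervalIntegral.integral_congr fun x hx => h (edge_top_mem ?_)
    rwa [Set.uIcc_of_le hlr] at hx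
  · congr 1
    refine intervalIntegral.integral_congr fun x hx => h (edge_right_mem hlr ?_)
    rwa [Set.uIcc_of_le neg_pi_le_pi] at hx
  · congr 1
    refine intervalIntegral.integral_congr fun x hx => h (edge_left_mem hlr ?_)
    rwa [Set.uIcc_of_le neg_pi_le_pi] at hx

lemma intervalIntegrable_edges {f : ℂ → ℂ} {l r : ℝ} (hlr : l ≤ r)
    (h : ContinuousOn f (stripEdge l r)) :
    IntervalIntegrable (fun x : ℝ => f (x + (-Real.pi : ℝ) * I)) MeasureTheory.volume l r ∧
    IntervalIntegrable (fun x : ℝ => f (x + (Real.pi : ℝ) * I)) MeasureTheory.volume l r ∧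
    IntervalIntegrable (fun y : ℝ => f (r + y * I)) MeasureTheory.volume (-Real.pi) Real.pi ∧
    IntervalIntegrable (fun y : ℝ => f (l + y * I)) MeasureTheory.volume (-Real.pi) Real.pi := by
  refine ⟨ContinuousOn.intervalIntegrable ?_, ContinuousOn.intervalIntegrable ?_,
    ContinuousOn.intervalIntegrable ?_, ContinuousOn.intervalIntegrable ?_⟩
  · rw [Set.uIcc_of_le hlr]
    exact h.comp (by fun_prop) fun x hx => edge_bottom_mem hx
  · rw [Set.uIcc_of_le hlr]
    exact h.comp (by fun_prop) fun x hx => edge_top_mem hx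
  · rw [Set.uIcc_of_le neg_pi_le_pi]
    exact h.comp (by fun_prop) fun x hx => edge_right_mem hlr hx
  · rw [Set.uIcc_of_le neg_pi_le_pi]
    exact h.comp (by fun_prop) fun x hx => edge_left_mem hlr hx

lemma stripBoundary_add {f g : ℂ → ℂ} {l r : ℝ} (hlr : l ≤ r)
    (hf : ContinuousOn f (stripEdge l r)) (hg : ContinuousOn g (stripEdge l r)) :
    stripBoundary (fun ζ => f ζ + g ζ) l r = stripBoundary f l r + stripBoundary g l r := by
  obtain ⟨f1, f2, f3, f4⟩ := intervalIntegrable_edges hlr hf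
  obtain ⟨g1, g2, g3, g4⟩ := intervalIntegrable_edges hlr hg
  unfold stripBoundary
  rw [intervalIntegral.integral_add f1 g1, intervalIntegral.integral_add f2 g2,
    intervalIntegral.integral_add f3 g3, intervalIntegral.integral_add f4 g4]
  ring

lemma stripBoundary_const_mul (c : ℂ) (f : ℂ → ℂ) (l r : ℝ) :
    stripBoundary (fun ζ => c * f ζ) l r = c * stripBoundary f l r := by
  unfold stripBoundary
  simp only [intervalIntegral.integral_const_mul]
  ring

lemma stripBoundary_sum {ι : Type*} (T : Finset ι) (f : ι → ℂ → ℂ) {l r : ℝ} (hlr : l ≤ r)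
    (hf : ∀ i ∈ T, ContinuousOn (f i) (stripEdge l r)) :
    stripBoundary (fun ζ => ∑ i ∈ T, f i ζ) l r = ∑ i ∈ T, stripBoundary (f i) l r := by
  classical
  induction T using Finset.induction_on with
  | empty => simp [stripBoundary]
  | insert a s ha ih =>
    simp only [Finset.sum_insert ha]
    rw [stripBoundary_add hlr (hf a (Finset.mem_insert_self _ _)), ih]
    · exact fun i hi => hf i (Finset.mem_insert_of_mem hi)
    · exact continuousOn_finsetSum _ fun i hi => hf i (Finset.mem_insert_of_mem hi)

lemma stripBoundary_eq_zero {f : ℂ → ℂ} {l r : ℝ} (hlr : l ≤ r)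
    (hf : ∀ ζ ∈ strip l r, DifferentiableAt ℂ f ζ) : stripBoundary f l r = 0 := by
  have h := integral_boundary_rect_eq_zero_of_differentiableOn f
    ((l : ℂ) + (-Real.pi : ℝ) * I) ((r : ℂ) + (Real.pi : ℝ) * I) ?_
  · simpa [stripBoundary] using h
  · intro ζ hζ
    refine (hf ζ ?_).differentiableWithinAt
    rw [mem_reProdIm] at hζ
    simpa [strip, Set.uIcc_of_le hlr, Set.uIcc_of_le neg_pi_le_pi] using hζ

lemma I_mul_integral_exp_div (w : ℂ) (r : ℝ) :
    I * (∫ y : ℝ in (-Real.pi)..Real.pi, exp (r + y * I) / (exp (r + y * I) - w))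
      = ∮ z in C(0, Real.exp r), (z - w)⁻¹ := by
  have hper : Function.Periodic (fun y : ℝ => exp (r + y * I) / (exp (r + y * I) - w))
      (2 * Real.pi) := by
    intro y
    have : (r + (y + 2 * Real.pi : ℝ) * I : ℂ) = (r + y * I) + 2 * Real.pi * I := by
      push_cast; ring
    simp only [this, exp_periodic _]
  have h := hper.intervalIntegral_add_eq (-Real.pi) 0
  rw [show -Real.pi + 2 * Real.pi = Real.pi by ring, zero_add] at h
  rw [h, circleIntegral, ← intervalIntegral.integral_const_mul]
  refine intervalIntegral.integral_congr fun y _ => ?_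
  simp only [deriv_circleMap, circleMap, zero_add, smul_eq_mul, ofReal_exp, exp_add]
  ring

lemma stripBoundary_exp_div {w : ℂ} {l r : ℝ} (hl : Real.exp l < ‖w‖) (hr : ‖w‖ < Real.exp r) :
    stripBoundary (fun ζ => exp ζ / (exp ζ - w)) l r = 2 * Real.pi * I := by
  have hh : ∀ x : ℝ, exp (x + (-Real.pi : ℝ) * I) = exp (x + (Real.pi : ℝ) * I) := by
    intro x
    rw [← exp_periodic]; congr 1; push_cast; ring
  unfold stripBoundary
  simp only [hh, sub_self, zero_add]
  rw [I_mul_integral_exp_div, I_mul_integral_exp_div,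
    circleIntegral.integral_sub_inv_of_mem_ball (by simpa using hr),
    circleIntegral_eq_zero_of_differentiable_on_off_countable (Real.exp_pos l).le
      Set.countable_empty, sub_zero]
  · intro z hz
    refine ContinuousAt.continuousWithinAt (ContinuousAt.inv₀ (by fun_prop) ?_)
    rintro h
    rw [sub_eq_zero.1 h] at hz
    simp at hz; linarith
  · rintro z ⟨hz, -⟩
    refine DifferentiableAt.inv (by fun_prop) ?_
    rintro h
    rw [sub_eq_zero.1 h] at hz
    simp at hz; linarith

lemma tendsto_sub_mul_div {A B : ℂ → ℂ} {p B' : ℂ} (hA : ContinuousAt A p)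
    (hB : HasDerivAt B B' p) (hB0 : B p = 0) (hB' : B' ≠ 0) :
    Tendsto (fun ζ => (ζ - p) * (A ζ / B ζ)) (𝓝[≠] p) (𝓝 (A p / B')) := by
  have h1 := (hasDerivAt_iff_tendsto_slope.1 hB).inv₀ hB'
  have h2 : Tendsto A (𝓝[≠] p) (𝓝 (A p)) := hA.tendsto.mono_left nhdsWithin_le_nhds
  rw [div_eq_mul_inv]
  refine (h2.mul h1).congr fun ζ => ?_
  rw [slope_def_field, hB0, sub_zero, inv_div]
  ring

lemma eq_log_of_exp_eq {ζ w : ℂ} {l r : ℝ} (hζ : ζ ∈ strip l r) (hw : w ∈ slitPlane)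
    (h : exp ζ = w) : ζ = log w := by
  rw [← h, log_exp _ hζ.2.2]
  refine lt_of_le_of_ne hζ.2.1 fun him => ?_
  rw [← h, mem_slitPlane_iff, exp_re, exp_im, ← him] at hw
  simp at hw
  exact absurd hw (not_lt.2 (Real.exp_pos _).le)

/-- The residue theorem on the rectangle `[l, r] × [-π, π]`, for simple poles at `log w_i`. -/
theorem stripBoundary_eq_sum_residues {ι : Type*} (T : Finset ι) {w res : ι → ℂ} {F : ℂ → ℂ}
    {l r : ℝ} (hlr : l ≤ r) (hinj : Set.InjOn w T) (hslit : ∀ i ∈ T, w i ∈ slitPlane)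
    (hl : ∀ i ∈ T, Real.exp l < ‖w i‖) (hr : ∀ i ∈ T, ‖w i‖ < Real.exp r)
    (hF : ∀ ζ ∈ strip l r, (∀ i ∈ T, exp ζ ≠ w i) → DifferentiableAt ℂ F ζ)
    (hres : ∀ i ∈ T, Tendsto (fun ζ => (ζ - log (w i)) * F ζ) (𝓝[≠] log (w i)) (𝓝 (res i))) :
    stripBoundary F l r = 2 * Real.pi * I * ∑ i ∈ T, res i := by
  classical
  set S : Finset ℂ := T.image fun i => log (w i) with hS
  have hw0 : ∀ i ∈ T, w i ≠ 0 := fun i hi => slitPlane_ne_zero (hslit i hi)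
  have hnS : ∀ ζ, ζ ∉ S → ∀ i ∈ T, ζ ∈ strip l r → exp ζ ≠ w i := by
    intro ζ hζ i hi hs h
    exact hζ (Finset.mem_image.2 ⟨i, hi, (eq_log_of_exp_eq hs (hslit i hi) h).symm⟩)
  have hint : ∀ p ∈ S, l < p.re ∧ p.re < r ∧ -Real.pi < p.im ∧ p.im < Real.pi := by
    intro p hp
    obtain ⟨i, hi, rfl⟩ := Finset.mem_image.1 hp
    have hpos : 0 < ‖w i‖ := norm_pos_iff.2 (hw0 i hi)
    refine ⟨?_, ?_, ?_, ?_⟩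
    · rw [log_re, Real.lt_log_iff_exp_lt hpos]; exact hl i hi
    · rw [log_re, Real.log_lt_iff_lt_exp hpos]; exact hr i hi
    · exact neg_pi_lt_log_im _
    · rw [log_im]
      exact lt_of_le_of_ne (arg_le_pi _) (mem_slitPlane_iff_arg.1 (hslit i hi)).1
  have hnhds : ∀ p ∈ S, strip l r ∈ 𝓝 p := by
    intro p hp
    obtain ⟨h1, h2, h3, h4⟩ := hint p hp
    have a1 := (continuous_re.tendsto p).eventually (Icc_mem_nhds h1 h2)
    have a2 := (continuous_im.tendsto p).eventually (Icc_mem_nhds h3 h4)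
    filter_upwards [a1, a2] with ζ b1 b2 using ⟨b1, b2⟩
  have hedge : ∀ ζ ∈ stripEdge l r, ζ ∉ S := by
    rintro ζ ⟨-, h⟩ hζ
    obtain ⟨h1, h2, h3, h4⟩ := hint ζ hζ
    rcases h with h | h | h | h <;> linarith
  set K : ι → ℂ → ℂ := fun i ζ => exp ζ / (exp ζ - w i) with hK
  have hKd : ∀ i ∈ T, ∀ ζ, exp ζ ≠ w i → DifferentiableAt ℂ (K i) ζ := fun i _ ζ h =>
    differentiableAt_exp.div (differentiableAt_exp.sub_const _) (sub_ne_zero.2 h)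
  set G : ℂ → ℂ := fun ζ => F ζ - ∑ i ∈ T, res i * K i ζ with hG
  have hGd : ∀ ζ ∈ strip l r, ζ ∉ S → DifferentiableAt ℂ G ζ := by
    intro ζ hζ hζS
    refine (hF ζ hζ fun i hi => hnS ζ hζS i hi hζ).sub ?_
    exact DifferentiableAt.fun_sum fun i hi =>
      (hKd i hi ζ (hnS ζ hζS i hi hζ)).const_mul _
  have hlim : ∀ p ∈ S, Tendsto (fun ζ => (ζ - p) * G ζ) (𝓝[≠] p) (𝓝 0) := by
    intro p hp
    obtain ⟨i, hi, rfl⟩ := Finset.mem_image.1 hp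
    have h1 := hres i hi
    have h2 : ∀ j ∈ T, Tendsto (fun ζ => (ζ - log (w i)) * (res j * K j ζ)) (𝓝[≠] log (w i))
        (𝓝 (if j = i then res i else 0)) := by
      intro j hj
      split_ifs with hji
      · subst hji
        have hB : HasDerivAt (fun ζ => exp ζ - w j) (w j) (log (w j)) := by
          have := (hasDerivAt_exp (log (w j))).sub_const (w j)
          rwa [exp_log (hw0 j hj)] at this
        have := (tendsto_sub_mul_div (A := exp) (B := fun ζ => exp ζ - w j)
          continuous_exp.continuousAt hB (by simp [exp_log (hw0 j hj)]) (hw0 j hj)).const_mul (res j)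
        rw [exp_log (hw0 j hj), div_self (hw0 j hj), mul_one] at this
        refine this.congr fun ζ => ?_
        simp only [hK]; ring
      · have hne : exp (log (w i)) ≠ w j := by
          rw [exp_log (hw0 i hi)]
          exact fun h => hji (hinj hj hi h.symm)
        have hc : ContinuousAt (fun ζ => (ζ - log (w i)) * (res j * K j ζ)) (log (w i)) :=
          (continuousAt_id.sub continuousAt_const).mul
            (continuousAt_const.mul (hKd j hj _ hne).continuousAt)
        have := hc.tendsto
        simp only [sub_self, zero_mul] at this
        exact this.mono_left nhdsWithin_le_nhds
    have h3 := h1.sub (tendsto_finsetSum T h2)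
    rw [Finset.sum_ite_eq' T i, if_pos hi, sub_self] at h3
    refine h3.congr fun ζ => ?_
    simp only [hG]
    rw [mul_sub, Finset.mul_sum]
  have hlittle : ∀ p ∈ S, (fun ζ => G ζ - G p) =o[𝓝[≠] p] fun ζ => (ζ - p)⁻¹ := by
    intro p hp
    have hne : ∀ᶠ ζ in 𝓝[≠] p, (ζ - p)⁻¹ = 0 → G ζ - G p = 0 := by
      filter_upwards [self_mem_nhdsWithin] with ζ hζ h
      exact absurd h (inv_ne_zero (sub_ne_zero.2 hζ))
    rw [Asymptotics.isLittleO_iff_tendsto' hne]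
    have h2 : Tendsto (fun ζ : ℂ => (ζ - p) * G p) (𝓝[≠] p) (𝓝 0) := by
      have hc : Continuous (fun ζ : ℂ => (ζ - p) * G p) := by fun_prop
      have := hc.tendsto p
      rw [sub_self, zero_mul] at this
      exact this.mono_left nhdsWithin_le_nhds
    have := (hlim p hp).sub h2
    rw [sub_zero] at this
    refine this.congr fun ζ => ?_
    rw [div_inv_eq_mul]; ring
  set G' : ℂ → ℂ := fun ζ => if ζ ∈ S then limUnder (𝓝[≠] ζ) G else G ζ with hG'
  have hG'd : ∀ ζ ∈ strip l r, DifferentiableAt ℂ G' ζ := by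
    intro ζ hζ
    have hfin : ∀ᶠ x in 𝓝 ζ, x ∉ S.erase ζ :=
      (S.erase ζ).finite_toSet.isClosed.isOpen_compl.mem_nhds (by simp)
    by_cases hζS : ζ ∈ S
    · have hU : {x | x ∈ strip l r ∧ x ∉ S.erase ζ} ∈ 𝓝 ζ := inter_mem (hnhds ζ hζS) hfin
      have hd := differentiableOn_update_limUnder_of_isLittleO hU (fun x hx =>
        (hGd x hx.1.1 fun hxS => hx.1.2
          (Finset.mem_erase.2 ⟨hx.2, hxS⟩)).differentiableWithinAt) (hlittle ζ hζS)
      refine (hd.differentiableAt hU).congr_of_eventuallyEq ?_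
      filter_upwards [hfin] with x hx
      rw [Function.update_apply]
      simp only [hG']
      by_cases hxζ : x = ζ
      · subst hxζ; simp [hζS]
      · rw [if_neg hxζ, if_neg fun h => hx (Finset.mem_erase.2 ⟨hxζ, h⟩)]
    · refine (hGd ζ hζ hζS).congr_of_eventuallyEq ?_
      rw [Finset.erase_eq_of_notMem hζS] at hfin
      filter_upwards [hfin] with x hx
      simp only [hG', if_neg hx]
  have hzero : stripBoundary G l r = 0 := by
    rw [← stripBoundary_eq_zero hlr hG'd]
    exact stripBoundary_congr hlr fun ζ hζ => by simp only [hG', if_neg (hedge ζ hζ)]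
  have hGc : ContinuousOn G (stripEdge l r) := fun ζ hζ =>
    (hGd ζ hζ.1 (hedge ζ hζ)).continuousAt.continuousWithinAt
  have hKc : ∀ i ∈ T, ContinuousOn (fun ζ => res i * K i ζ) (stripEdge l r) := fun i hi ζ hζ =>
    ((hKd i hi ζ (hnS ζ (hedge ζ hζ) i hi hζ.1)).const_mul
      (res i)).continuousAt.continuousWithinAt
  have hFG : stripBoundary F l r = stripBoundary (fun ζ => G ζ + ∑ i ∈ T, res i * K i ζ) l r := by
    congr 1; ext ζ; simp [hG]
  rw [hFG, stripBoundary_add hlr hGc (continuousOn_finsetSum _ hKc), hzero, zero_add,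
    stripBoundary_sum T _ hlr hKc, Finset.mul_sum]
  refine Finset.sum_congr rfl fun i hi => ?_
  rw [stripBoundary_const_mul, stripBoundary_exp_div (hl i hi) (hr i hi)]
  ring

/-! ### Poles and residues of the kernel -/

/-- The denominator of `e_q(az) / (ε_q(z) - 1)`. -/
def kernDen (q a : ℝ) (z : ℂ) : ℂ :=
  bigExp q (-(a * z)) * (bigExp q (z / 2) - bigExp q (-(z / 2)))

/-- The integrand in the coordinate `ζ = log z`. -/
def stripKern (q a : ℝ) (s ζ : ℂ) : ℂ :=
  exp (s * ζ) * bigExp q (-(exp ζ / 2)) / kernDen q a (exp ζ)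

lemma smallExp_eq (q : ℝ) (z : ℂ) : smallExp q z = 1 / bigExp q (-z) := by
  rw [smallExp, bigExp, neg_mul_neg]

lemma kern_eq {q a : ℝ} {z : ℂ} (hz : bigExp q (-(z / 2)) ≠ 0) :
    kern q a z = bigExp q (-(z / 2)) / kernDen q a z := by
  rw [kern, epsExp, smallExp_eq, smallExp_eq, kernDen]
  rw [show 1 / bigExp q (-(z / 2)) * bigExp q (z / 2) - 1
    = (bigExp q (z / 2) - bigExp q (-(z / 2))) / bigExp q (-(z / 2)) by field_simp]
  rw [div_div_eq_mul_div, div_mul_eq_mul_div, one_mul, div_div]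

lemma polar_eq_exp {r : ℝ} (hr : 0 < r) (θ : ℝ) : polar r θ = exp (Real.log r + θ * I) := by
  rw [polar, exp_add, ← ofReal_exp, Real.exp_log hr]

lemma integrand_mul_polar {q a : ℝ} {s : ℂ} {r θ : ℝ} (hr : 0 < r)
    (h : bigExp q (-(polar r θ / 2)) ≠ 0) :
    integrand q a s r θ * polar r θ = stripKern q a s (Real.log r + θ * I) := by
  have hr' : (r : ℂ) ≠ 0 := by exact_mod_cast hr.ne'
  have hp : polarPow r θ (s - 1) * polar r θ = exp (s * (Real.log r + θ * I)) := by
    rw [polarPow, cpow_def_of_ne_zero hr', polar_eq_exp hr, ← ofReal_log hr.le, ← exp_add,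
      ← exp_add]
    congr 1; ring
  rw [integrand, kern_eq h, stripKern, ← polar_eq_exp hr, ← hp]
  ring

/-- The nonzero singularities of the kernel: `2 i ξ_k`, `-2 i ξ_k` and the poles of `e_q(az)`. -/
def sing (q a : ℝ) : (ℕ ⊕ ℕ) ⊕ ℕ → ℂ
  | .inl (.inl k) => 2 * (I * xi q (k + 1))
  | .inl (.inr k) => 2 * (-I * xi q (k + 1))
  | .inr k => pole q a k

/-- The residue of `z^{s-1} e_q(az) / (ε_q(z) - 1)` at `sing q a i`. -/
def singRes (q a : ℝ) (s : ℂ) : (ℕ ⊕ ℕ) ⊕ ℕ → ℂ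
  | .inl (.inl k) => 2 ^ (s - 1) * zeroTerm q a s I (k + 1)
  | .inl (.inr k) => 2 ^ (s - 1) * zeroTerm q a s (-I) (k + 1)
  | .inr k => -(1 / (2 * qInf q q)) * poleTerm q a s k

lemma pole_pos {q a : ℝ} (hq0 : 0 < q) (hq1 : q < 1) (ha : 0 < a) (k : ℕ) : 0 < pole q a k :=
  div_pos (inv_pos.2 (pow_pos hq0 k)) (mul_pos ha (by linarith))

lemma node_mul_pole {q a : ℝ} (hq0 : 0 < q) (hq1 : q < 1) (ha : 0 < a) (j k : ℕ) :
    node q j * (a * pole q a k) = q ^ j / q ^ k := by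
  have : 0 < 1 - q := by linarith
  rw [node, pole]; field_simp

lemma norm_sing_pole {q a : ℝ} (hq0 : 0 < q) (hq1 : q < 1) (ha : 0 < a) (k : ℕ) :
    ‖sing q a (.inr k)‖ = pole q a k := by
  rw [sing, norm_real, Real.norm_of_nonneg (pole_pos hq0 hq1 ha k).le]

lemma norm_sing_zero {q a : ℝ} (hq0 : 0 < q) (hq1 : q < 1) (k : ℕ) :
    ‖sing q a (.inl (.inl k))‖ = 2 * xi q (k + 1) ∧
      ‖sing q a (.inl (.inr k))‖ = 2 * xi q (k + 1) := by
  have := (xi_succ_pos hq0 hq1 k).le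
  simp [sing, abs_of_nonneg this]

lemma sing_mem_slitPlane {q a : ℝ} (hq0 : 0 < q) (hq1 : q < 1) (ha : 0 < a)
    (i : (ℕ ⊕ ℕ) ⊕ ℕ) : sing q a i ∈ slitPlane := by
  rw [mem_slitPlane_iff]
  rcases i with (k | k) | k
  · right; simpa [sing] using (xi_succ_pos hq0 hq1 k).ne'
  · right; simpa [sing] using (xi_succ_pos hq0 hq1 k).ne'
  · left; simpa [sing] using pole_pos hq0 hq1 ha k

lemma pole_injective {q a : ℝ} (hq0 : 0 < q) (hq1 : q < 1) (ha : 0 < a) :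
    Function.Injective (pole q a) := by
  intro j k h
  have h1 := node_mul_pole hq0 hq1 ha 0 j
  rw [h, node_mul_pole hq0 hq1 ha 0 k, pow_zero, one_div, one_div, inv_inj] at h1
  exact (pow_right_injective₀ hq0 hq1.ne h1).symm

lemma sing_injective {q a : ℝ} (hq0 : 0 < q) (hq1 : q < 1) (ha : 0 < a) :
    Function.Injective (sing q a) := by
  have hxi : ∀ k, 0 < xi q (k + 1) := xi_succ_pos hq0 hq1
  have hpo : ∀ k, 0 < pole q a k := pole_pos hq0 hq1 ha
  have hinj : ∀ j k, xi q (j + 1) = xi q (k + 1) → j = k := fun j k h => by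
    simpa using (strictMono_xi hq0 hq1).injective h
  intro i j h
  have hre := congrArg re h
  have him := congrArg im h
  rcases i with (i | i) | i <;> rcases j with (j | j) | j <;> simp [sing] at hre him
  · rw [hinj i j him]
  · linarith [hxi i, hxi j]
  · exact absurd hre (hpo j).ne
  · linarith [hxi i, hxi j]
  · rw [hinj i j him]
  · exact absurd hre (hpo j).ne
  · exact absurd hre (hpo i).ne'
  · exact absurd hre (hpo i).ne'
  · rw [pole_injective hq0 hq1 ha hre]

lemma re_eq_zero_of_bigExp_eq {q : ℝ} (hq0 : 0 < q) (hq1 : q < 1) {w : ℂ}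
    (h : bigExp q w = bigExp q (-w)) : w.re = 0 := by
  by_contra hre
  have hw0 : w ≠ 0 := fun h0 => hre (by simp [h0])
  have hn : 0 < ‖w‖ := norm_pos_iff.2 hw0
  have := norm_bigExp_le_sector hq0 hq1 (σ := |w.re| / ‖w‖) (by positivity) hw0
    (by rw [div_mul_cancel₀ _ hn.ne'])
  rw [h, sub_self, norm_zero, mul_zero, norm_le_zero_iff] at this
  rcases le_total 0 w.re with h1 | h1
  · exact bigExp_ne_zero_of_re_nonneg hq0 hq1 h1 (h.trans this)
  · exact bigExp_ne_zero_of_re_nonneg hq0 hq1 (z := -w) (by simpa using h1) this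

lemma exists_sing_of_kernDen_eq_zero {q a : ℝ} (hq0 : 0 < q) (hq1 : q < 1) (ha : 0 < a) {z : ℂ}
    (hz : z ≠ 0) (h : kernDen q a z = 0) : ∃ i, z = sing q a i := by
  have hq' : 0 < 1 - q := by linarith
  rcases mul_eq_zero.1 h with h | h
  · obtain ⟨k, hk⟩ := (bigExp_eq_zero_iff hq0 hq1 _).1 h
    refine ⟨.inr k, ?_⟩
    have h1 : (node q k : ℂ) * (a * z) = 1 := by linear_combination -hk
    have h2 : (node q k : ℂ) * (a * pole q a k) = 1 := by
      have := node_mul_pole hq0 hq1 ha k k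
      rw [div_self (pow_pos hq0 k).ne'] at this
      exact_mod_cast this
    have hn : (node q k : ℂ) ≠ 0 := by exact_mod_cast (node_pos hq0 hq1 k).ne'
    have ha' : (a : ℂ) ≠ 0 := by exact_mod_cast ha.ne'
    exact mul_left_cancel₀ ha' (mul_left_cancel₀ hn (h1.trans h2.symm))
  · have hE := sub_eq_zero.1 h
    have hre := re_eq_zero_of_bigExp_eq hq0 hq1 hE
    obtain ⟨y, hy⟩ : ∃ y : ℝ, z / 2 = I * y := ⟨(z / 2).im, by
      apply Complex.ext <;> simp [hre]⟩
    rw [hy] at hE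
    have hz2 : z = 2 * (I * y) := by rw [← hy]; ring
    rcases lt_trichotomy y 0 with h0 | h0 | h0
    · have : (-y) ∈ posZeros q := ⟨by linarith, by
        rw [qSin, div_eq_zero_iff]; left; push_cast; rw [mul_neg, neg_neg, hE, sub_self]⟩
      rw [← range_xi hq0 hq1] at this
      obtain ⟨k, hk⟩ := this
      refine ⟨.inl (.inr k), ?_⟩
      rw [sing, show xi q (k + 1) = -y from hk, hz2]; push_cast; ring
    · exact absurd (by rw [hz2, h0]; simp) hz
    · have : y ∈ posZeros q := ⟨h0, by rw [qSin, hE, sub_self, zero_div]⟩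
      rw [← range_xi hq0 hq1] at this
      obtain ⟨k, hk⟩ := this
      exact ⟨.inl (.inl k), by rw [sing, show xi q (k + 1) = y from hk, hz2]⟩

lemma differentiable_kernDen {q a : ℝ} (hq0 : 0 < q) (hq1 : q < 1) :
    Differentiable ℂ (kernDen q a) := by
  have h := differentiable_bigExp hq0 hq1
  unfold kernDen
  exact (h.comp (by fun_prop)).mul ((h.comp (by fun_prop)).sub (h.comp (by fun_prop)))

lemma differentiableAt_stripKern {q a : ℝ} (hq0 : 0 < q) (hq1 : q < 1) {s ζ : ℂ}
    (h : kernDen q a (exp ζ) ≠ 0) : DifferentiableAt ℂ (stripKern q a s) ζ := by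
  have h1 : DifferentiableAt ℂ (fun ζ => bigExp q (-(exp ζ / 2))) ζ :=
    ((differentiable_bigExp hq0 hq1).comp (g := bigExp q) (f := fun ζ => -(exp ζ / 2))
      (by fun_prop)) ζ
  have h2 : DifferentiableAt ℂ (fun ζ => kernDen q a (exp ζ)) ζ :=
    ((differentiable_kernDen hq0 hq1).comp differentiable_exp) ζ
  have h3 : DifferentiableAt ℂ (fun ζ => exp (s * ζ)) ζ := by fun_prop
  exact (h3.mul h1).div h2 h

lemma cpow_sub_one_eq {w : ℂ} (hw : w ≠ 0) (s : ℂ) : w ^ (s - 1) = w ^ s / w := by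
  rw [cpow_sub _ _ hw, cpow_one]

lemma tendsto_sub_log_mul_stripKern {q a : ℝ} (hq0 : 0 < q) (hq1 : q < 1) {s w D : ℂ} (hw : w ≠ 0)
    (hD : HasDerivAt (kernDen q a) D w) (h0 : kernDen q a w = 0) (hD0 : D ≠ 0) :
    Tendsto (fun ζ => (ζ - log w) * stripKern q a s ζ) (𝓝[≠] log w)
      (𝓝 (w ^ (s - 1) * bigExp q (-(w / 2)) / D)) := by
  have hA : Continuous fun ζ => exp (s * ζ) * bigExp q (-(exp ζ / 2)) :=
    (by fun_prop : Continuous fun ζ => exp (s * ζ)).mul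
      ((differentiable_bigExp hq0 hq1).continuous.comp (by fun_prop))
  have hB : HasDerivAt (fun ζ => kernDen q a (exp ζ)) (D * w) (log w) := by
    have h1 := hasDerivAt_exp (log w)
    rw [exp_log hw] at h1
    exact HasDerivAt.comp (log w) (by rwa [exp_log hw]) h1
  have h := tendsto_sub_mul_div hA.continuousAt hB (by rwa [exp_log hw]) (mul_ne_zero hD0 hw)
  have e : w ^ (s - 1) * bigExp q (-(w / 2)) / D
      = exp (s * log w) * bigExp q (-(exp (log w) / 2)) / (D * w) := by
    rw [cpow_sub_one_eq hw, cpow_def_of_ne_zero hw, exp_log hw, mul_comm s]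
    field_simp
  rw [e]
  exact h

lemma ofReal_mul_cpow {x : ℝ} (hx : 0 < x) {w : ℂ} (hw : w ≠ 0) (s : ℂ) :
    ((x : ℂ) * w) ^ s = (x : ℂ) ^ s * w ^ s := by
  have hx' : (x : ℂ) ≠ 0 := by exact_mod_cast hx.ne'
  rw [cpow_def_of_ne_zero (mul_ne_zero hx' hw), cpow_def_of_ne_zero hx', cpow_def_of_ne_zero hw,
    log_ofReal_mul hx hw, ← exp_add, ofReal_log hx.le]
  congr 1; ring

lemma hasDerivAt_kernDen_zero {q a : ℝ} (hq0 : 0 < q) (hq1 : q < 1) {w : ℂ}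
    (h : bigExp q (w / 2) = bigExp q (-(w / 2))) :
    HasDerivAt (kernDen q a)
      (bigExp q (-(a * w)) * ((deriv (bigExp q) (w / 2) + deriv (bigExp q) (-(w / 2))) / 2)) w := by
  have hE := differentiable_bigExp hq0 hq1
  have h1 : HasDerivAt (fun z : ℂ => bigExp q (z / 2)) (deriv (bigExp q) (w / 2) * (1 / 2)) w :=
    HasDerivAt.comp (h₂ := bigExp q) (h := fun z : ℂ => z / 2) w (hE _).hasDerivAt
      ((hasDerivAt_id w).div_const 2)
  have h2 : HasDerivAt (fun z : ℂ => bigExp q (-(z / 2)))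
      (deriv (bigExp q) (-(w / 2)) * -(1 / 2)) w :=
    HasDerivAt.comp (h₂ := bigExp q) (h := fun z : ℂ => -(z / 2)) w (hE _).hasDerivAt
      ((hasDerivAt_id w).div_const 2).neg
  have h3 : DifferentiableAt ℂ (fun z : ℂ => bigExp q (-(a * z))) w :=
    (hE.comp (g := bigExp q) (f := fun z : ℂ => -(a * z)) (by fun_prop)) w
  refine (h3.hasDerivAt.mul (h1.sub h2)).congr_deriv ?_
  simp only [Pi.sub_apply, h, sub_self, mul_zero, zero_add]
  ring

lemma tendsto_stripKern_zero {q a : ℝ} (hq0 : 0 < q) (hq1 : q < 1) (s : ℂ) {u : ℂ}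
    (hu : u = I ∨ u = -I) (k : ℕ) :
    Tendsto (fun ζ => (ζ - log (2 * (u * xi q (k + 1)))) * stripKern q a s ζ)
      (𝓝[≠] log (2 * (u * xi q (k + 1))))
      (𝓝 (2 ^ (s - 1) * zeroTerm q a s u (k + 1))) := by
  set x := xi q (k + 1) with hx
  have hS : qSin q x = 0 := qSin_xi hq0 hq1 k
  have hx0 : (x : ℂ) ≠ 0 := by exact_mod_cast (xi_succ_pos hq0 hq1 k).ne'
  have hu0 : u ≠ 0 := by rcases hu with rfl | rfl <;> simp
  have hw : 2 * (u * x) ≠ 0 := by simp [hu0, hx0]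
  have e1 := bigExp_eq_of_qSin_eq_zero hS
  have ed := (hasDerivAt_qSin hq0 hq1 (x : ℂ)).deriv
  have e2 : bigExp q (u * x) = bigExp q (-(u * x)) := by
    rcases hu with rfl | rfl
    · exact e1.symm
    · rw [neg_mul, neg_neg]; exact e1
  have e3 : bigExp q (-(u * x)) = qCos q x := by
    rw [qCos_eq_of_qSin_eq_zero hS]
    rcases hu with rfl | rfl
    · exact e1
    · rw [neg_mul, neg_neg]
  have e4 : (deriv (bigExp q) (u * x) + deriv (bigExp q) (-(u * x))) / 2 = deriv (qSin q) x := by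
    rw [ed]
    rcases hu with rfl | rfl
    · rfl
    · rw [neg_mul, neg_neg, add_comm]
  have hhalf : 2 * (u * x) / 2 = u * x := by ring
  have hD := hasDerivAt_kernDen_zero (a := a) hq0 hq1 (w := 2 * (u * x)) (by rw [hhalf, e2])
  rw [hhalf, e4] at hD
  have hre : (-((a : ℂ) * (2 * (u * x)))).re = 0 := by rcases hu with rfl | rfl <;> simp
  have hEa : bigExp q (-((a : ℂ) * (2 * (u * x)))) ≠ 0 :=
    bigExp_ne_zero_of_re_nonneg hq0 hq1 hre.ge
  have h := tendsto_sub_log_mul_stripKern (s := s) hq0 hq1 hw hD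
    (by rw [kernDen, hhalf, e2, sub_self, mul_zero])
    (mul_ne_zero hEa (deriv_qSin_ne_zero hq0 hq1 hS))
  convert h using 2
  have hc := ofReal_mul_cpow (x := 2) two_pos (mul_ne_zero hu0 hx0) (s - 1)
  rw [ofReal_ofNat] at hc
  rw [hc, zeroTerm, smallExp_eq, hhalf, e3, ← hx,
    show 2 * u * (a : ℂ) * x = a * (2 * (u * x)) by ring]
  field_simp

lemma prod_one_sub_div_pow {q : ℝ} (hq0 : 0 < q) (k : ℕ) :
    (∏ j ∈ Finset.range k, (1 - (q : ℂ) ^ j / (q : ℂ) ^ k)) * (q : ℂ) ^ (k * (k + 1) / 2)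
      = (-1) ^ k * qFin q q k := by
  have hq : (q : ℂ) ≠ 0 := by exact_mod_cast hq0.ne'
  induction k with
  | zero => simp [qFin]
  | succ k ih =>
    have e : (k + 1) * (k + 1 + 1) / 2 = k * (k + 1) / 2 + (k + 1) := by
      have : (k + 1) * (k + 1 + 1) = k * (k + 1) + 2 * (k + 1) := by ring
      omega
    have e2 : ∀ j ∈ Finset.range k, 1 - (q : ℂ) ^ (j + 1) / (q : ℂ) ^ (k + 1)
        = 1 - (q : ℂ) ^ j / (q : ℂ) ^ k := fun j _ => by
      rw [pow_succ, pow_succ, mul_div_mul_right _ _ hq]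
    have e3 : qFin q q (k + 1) = qFin q q k * (1 - (q : ℂ) ^ (k + 1)) := by
      rw [qFin, Finset.prod_range_succ, ← qFin, pow_succ' (q : ℂ) k]
    rw [Finset.prod_range_succ', Finset.prod_congr rfl e2, e, pow_add, e3, pow_succ (-1 : ℂ), pow_zero]
    calc _ = ((∏ j ∈ Finset.range k, (1 - (q : ℂ) ^ j / (q : ℂ) ^ k)) * (q : ℂ) ^ (k * (k + 1) / 2))
          * ((1 - 1 / (q : ℂ) ^ (k + 1)) * (q : ℂ) ^ (k + 1)) := by ring
      _ = _ := by
        rw [ih, sub_mul, one_div_mul_cancel (pow_ne_zero _ hq)]; ring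

lemma qInf_self_ne_zero {q : ℝ} (hq0 : 0 < q) (hq1 : q < 1) : qInf q q ≠ 0 := by
  have hq' : (1 - (q : ℂ)) ≠ 0 := by
    have : ((1 - q : ℝ) : ℂ) ≠ 0 := by exact_mod_cast (by linarith : (1 - q) ≠ 0)
    simpa using this
  have e : qInf q q = bigExp q (-(q / (1 - q))) := by
    rw [bigExp]; congr 1; field_simp
  rw [e, Ne, bigExp_eq_zero_iff hq0 hq1]
  rintro ⟨k, hk⟩
  have h1 : ((q ^ (k + 1) : ℝ) : ℂ) = 1 := by
    simp only [node] at hk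
    push_cast at hk ⊢
    field_simp at hk
    linear_combination -hk
  have h2 : q ^ (k + 1) = 1 := by exact_mod_cast h1
  exact (pow_lt_one₀ hq0.le hq1 (by omega)).ne h2

lemma hasDerivAt_bigExp_pole {q a : ℝ} (hq0 : 0 < q) (hq1 : q < 1) (ha : 0 < a) (k : ℕ) :
    HasDerivAt (fun z : ℂ => bigExp q (-(a * z)))
      ((∏ j ∈ Finset.range k, (1 - (q : ℂ) ^ j / (q : ℂ) ^ k)) * -(1 / (pole q a k : ℂ))
        * qInf q q) (pole q a k) := by
  have hq' : (1 - (q : ℂ)) ≠ 0 := by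
    have : ((1 - q : ℝ) : ℂ) ≠ 0 := by exact_mod_cast (by linarith : (1 - q) ≠ 0)
    simpa using this
  have hq : (q : ℂ) ≠ 0 := by exact_mod_cast hq0.ne'
  have ha' : (a : ℂ) ≠ 0 := by exact_mod_cast ha.ne'
  have hp : (pole q a k : ℂ) ≠ 0 := by exact_mod_cast (pole_pos hq0 hq1 ha k).ne'
  have hE := differentiable_bigExp hq0 hq1
  set P : ℂ → ℂ := fun z => ∏ j ∈ Finset.range k, (1 + (node q j : ℂ) * -(a * z)) with hP
  set Q : ℂ → ℂ := fun z => bigExp q ((q : ℂ) ^ (k + 1) * -(a * z)) with hQ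
  have hfac : (fun z : ℂ => bigExp q (-(a * z)))
      = fun z => P z * (1 + (node q k : ℂ) * -(a * z)) * Q z := by
    ext z
    rw [bigExp_eq_prod_mul hq0 hq1 (k + 1), Finset.prod_range_succ]
  have hn : ∀ j, (node q j : ℂ) * (a * pole q a k) = (q : ℂ) ^ j / (q : ℂ) ^ k := fun j => by
    exact_mod_cast node_mul_pole hq0 hq1 ha j k
  have hk0 : 1 + (node q k : ℂ) * -(a * pole q a k) = 0 := by
    rw [mul_neg, hn, div_self (pow_ne_zero _ hq)]; ring
  have hPd : DifferentiableAt ℂ P (pole q a k) := by fun_prop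
  have hQd : DifferentiableAt ℂ Q (pole q a k) :=
    (hE.comp (g := bigExp q) (f := fun z : ℂ => (q : ℂ) ^ (k + 1) * -(a * z)) (by fun_prop)) _
  have hlin : HasDerivAt (fun z : ℂ => 1 + (node q k : ℂ) * -(a * z)) (-((node q k : ℂ) * a))
      (pole q a k) := by
    have := ((((hasDerivAt_id (pole q a k : ℂ)).const_mul (a : ℂ)).neg).const_mul
      (node q k : ℂ)).const_add 1
    simpa using this
  rw [hfac]
  refine ((hPd.hasDerivAt.mul hlin).mul hQd.hasDerivAt).congr_deriv ?_
  have e1 : (node q k : ℂ) * a = 1 / pole q a k := by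
    rw [eq_div_iff hp, mul_assoc, hn, div_self (pow_ne_zero _ hq)]
  have e2 : P (pole q a k) = ∏ j ∈ Finset.range k, (1 - (q : ℂ) ^ j / (q : ℂ) ^ k) := by
    refine Finset.prod_congr rfl fun j _ => ?_
    rw [mul_neg, hn, sub_eq_add_neg]
  have e3 : Q (pole q a k) = qInf q q := by
    simp only [hQ, bigExp]
    congr 1
    rw [pole]; push_cast; field_simp; ring
  simp only [Pi.mul_apply, hk0, e1, e2, e3]
  ring

lemma qFin_self_ne_zero {q : ℝ} (hq0 : 0 < q) (hq1 : q < 1) (k : ℕ) : qFin q q k ≠ 0 := by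
  rw [qFin, Finset.prod_ne_zero_iff]
  intro j _ h
  have h1 : q * q ^ j = 1 := by
    have : (q : ℂ) * (q : ℂ) ^ j = 1 := by linear_combination -h
    exact_mod_cast this
  have := pow_lt_one₀ hq0.le hq1 (n := j + 1) (by omega)
  rw [pow_succ'] at this
  linarith

lemma tendsto_stripKern_pole {q a : ℝ} (hq0 : 0 < q) (hq1 : q < 1) (ha : 0 < a) (s : ℂ) (k : ℕ) :
    Tendsto (fun ζ => (ζ - log (pole q a k)) * stripKern q a s ζ)
      (𝓝[≠] log (pole q a k)) (𝓝 (-(1 / (2 * qInf q q)) * poleTerm q a s k)) := by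
  have hq : (q : ℂ) ≠ 0 := by exact_mod_cast hq0.ne'
  have hpos := pole_pos hq0 hq1 ha k
  have hp : (pole q a k : ℂ) ≠ 0 := by exact_mod_cast hpos.ne'
  have hE := differentiable_bigExp hq0 hq1
  have hprod := prod_one_sub_div_pow hq0 k
  have hqF := qFin_self_ne_zero hq0 hq1 k
  have hqI := qInf_self_ne_zero hq0 hq1
  have hz : bigExp q (-(a * pole q a k : ℂ)) = 0 := by
    rw [bigExp_eq_zero_iff hq0 hq1]
    refine ⟨k, ?_⟩
    have := node_mul_pole hq0 hq1 ha k k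
    rw [div_self (pow_pos hq0 k).ne'] at this
    have h2 : (node q k : ℂ) * (a * pole q a k) = 1 := by exact_mod_cast this
    linear_combination -h2
  set Pk := ∏ j ∈ Finset.range k, (1 - (q : ℂ) ^ j / (q : ℂ) ^ k) with hPk
  have hP0 : Pk ≠ 0 := by
    intro h0
    rw [h0, zero_mul] at hprod
    exact mul_ne_zero (pow_ne_zero _ (by norm_num)) hqF hprod.symm
  have hS0 : bigExp q ((pole q a k : ℂ) / 2) - bigExp q (-((pole q a k : ℂ) / 2)) ≠ 0 := by
    intro h0
    have := re_eq_zero_of_bigExp_eq hq0 hq1 (sub_eq_zero.1 h0)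
    rw [show (pole q a k : ℂ) / 2 = ((pole q a k / 2 : ℝ) : ℂ) by push_cast; ring, ofReal_re] at this
    linarith
  have hd2 : DifferentiableAt ℂ (fun z : ℂ => bigExp q (z / 2) - bigExp q (-(z / 2)))
      (pole q a k) :=
    ((hE.comp (g := bigExp q) (f := fun z : ℂ => z / 2) (by fun_prop)).sub
      (hE.comp (g := bigExp q) (f := fun z : ℂ => -(z / 2)) (by fun_prop))) _
  have hD := (hasDerivAt_bigExp_pole hq0 hq1 ha k).mul hd2.hasDerivAt
  rw [hz, zero_mul, add_zero] at hD
  have h := tendsto_sub_log_mul_stripKern (a := a) (s := s) hq0 hq1 hp hD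
    (by rw [kernDen, hz, zero_mul])
    (mul_ne_zero (mul_ne_zero (mul_ne_zero hP0 (neg_ne_zero.2 (one_div_ne_zero hp))) hqI) hS0)
  convert h using 2
  have e : (-1) ^ k * (q : ℂ) ^ (k * (k + 1) / 2) / qFin q q k = 1 / Pk := by
    rw [div_eq_div_iff hqF hP0]
    have h1 : ((-1 : ℂ) ^ k) * (-1) ^ k = 1 := by rw [← mul_pow]; simp
    linear_combination (-1 : ℂ) ^ k * hprod + qFin q q k * h1
  rw [poleTerm, qSinh, cpow_sub_one_eq hp, e, ← hPk]
  field_simp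

/-! ### Growth estimates and convergence of the series -/

lemma norm_exp_mul_le (s : ℂ) {ζ : ℂ} (h0 : 0 ≤ ζ.re) (h1 : |ζ.im| ≤ Real.pi) :
    ‖exp (s * ζ)‖ ≤ Real.exp (Real.pi * |s.im|) * Real.exp ζ.re ^ ⌈|s.re|⌉₊ := by
  rw [norm_exp, ← Real.exp_nat_mul, ← Real.exp_add, Real.exp_le_exp, mul_re]
  have e1 : s.re * ζ.re ≤ ⌈|s.re|⌉₊ * ζ.re :=
    mul_le_mul_of_nonneg_right ((le_abs_self _).trans (Nat.le_ceil _)) h0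
  have e2 : -(s.im * ζ.im) ≤ Real.pi * |s.im| := by
    refine (neg_le_abs _).trans ?_
    rw [abs_mul, mul_comm]
    exact mul_le_mul_of_nonneg_right h1 (abs_nonneg _)
  linarith

lemma norm_cpow_le_pow (s : ℂ) {w : ℂ} (hw : 1 ≤ ‖w‖) :
    ‖w ^ s‖ ≤ Real.exp (Real.pi * |s.im|) * ‖w‖ ^ ⌈|s.re|⌉₊ := by
  have hpos : 0 < ‖w‖ := by linarith
  have h := norm_exp_mul_le s (ζ := log w) (by rw [log_re]; exact Real.log_nonneg hw)
    (by rw [log_im]; exact abs_arg_le_pi w)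
  rwa [log_re, Real.exp_log hpos, mul_comm s, ← cpow_def_of_ne_zero (norm_pos_iff.1 hpos)] at h

lemma summable_zeroTerm {q a : ℝ} (hq0 : 0 < q) (hq1 : q < 1) (ha : 0 < a) (s : ℂ) {u : ℂ}
    (hu : u = I ∨ u = -I) : Summable fun k : ℕ => zeroTerm q a s u (k + 1) := by
  have hq' : 0 < 1 - q := by linarith
  set m := ⌈|(s - 1).re|⌉₊ with hm
  set A := Real.exp (Real.pi * |(s - 1).im|) with hA
  have hA0 : 0 < A := Real.exp_pos _
  set N := node q (m + 4) with hN
  have hN0 : 0 < N := node_pos hq0 hq1 _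
  have hun : ‖u‖ = 1 := by rcases hu with rfl | rfl <;> simp
  have hs : Summable fun k : ℕ => A * (2 / (1 - q)) / (N * (2 * a)) ^ (m + 4)
      * (1 / ((k + 1 : ℕ) : ℝ) ^ 2) :=
    ((summable_nat_add_iff (f := fun k : ℕ => 1 / (k : ℝ) ^ 2) 1).2
      (Real.summable_one_div_nat_pow.2 one_lt_two)).mul_left _
  refine Summable.of_norm_bounded hs fun k => ?_
  rw [zeroTerm]
  have hS := qSin_xi hq0 hq1 k
  have hxk := le_xi hq0 hq1 (k + 1)
  set x := xi q (k + 1) with hx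
  have hk1 : (1 : ℝ) ≤ ((k + 1 : ℕ) : ℝ) := by exact_mod_cast Nat.succ_pos k
  have hx1 : 1 ≤ x := hk1.trans hxk
  have hux : ‖u * (x : ℂ)‖ = x := by
    rw [norm_mul, hun, one_mul, norm_real, Real.norm_of_nonneg (by linarith)]
  have h1 : ‖(u * (x : ℂ)) ^ (s - 1)‖ ≤ A * x ^ m := by
    have := norm_cpow_le_pow (s - 1) (w := u * (x : ℂ)) (by rw [hux]; exact hx1)
    rwa [hux] at this
  have h2 : ‖smallExp q (2 * u * a * x)‖ ≤ 1 / (N * (2 * a) * x) ^ (m + 4) := by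
    rw [smallExp_eq, norm_div, norm_one]
    have hre : 0 ≤ (-(2 * u * a * x) : ℂ).re := by rcases hu with rfl | rfl <;> simp
    have := pow_le_norm_bigExp hq0 hq1 (m + 4) hre
    have hn : ‖(-(2 * u * a * x) : ℂ)‖ = 2 * a * x := by
      rw [norm_neg]
      simp [hun, abs_of_pos ha, abs_of_pos (by linarith : 0 < x)]
    rw [hn] at this
    rw [mul_assoc N]
    exact one_div_le_one_div_of_le (by positivity) this
  have h3 : ‖qCos q x / deriv (qSin q) x‖ ≤ 2 / (1 - q) * x ^ 2 := by
    have hd := norm_pos_iff.2 (deriv_qSin_ne_zero hq0 hq1 hS)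
    have := norm_qCos_le_norm_deriv_qSin hq0 hq1 hS
    rw [norm_div, div_le_iff₀ hd]
    have hden : 1 + ((1 - q) * x) ^ 2 ≤ 2 * x ^ 2 := by
      have : ((1 - q) * x) ^ 2 ≤ x ^ 2 := by
        refine pow_le_pow_left₀ (by positivity) ?_ 2
        nlinarith
      nlinarith
    rw [← mul_div_assoc, div_le_iff₀ (by positivity)] at this
    calc ‖qCos q x‖ = ‖qCos q x‖ * (1 - q) / (1 - q) := by field_simp
      _ ≤ ‖deriv (qSin q) x‖ * (1 + ((1 - q) * x) ^ 2) / (1 - q) := by gcongr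
      _ ≤ ‖deriv (qSin q) x‖ * (2 * x ^ 2) / (1 - q) := by gcongr
      _ = _ := by ring
  have hx0 : 0 < x := by linarith
  calc _ ≤ A * x ^ m * (1 / (N * (2 * a) * x) ^ (m + 4)) * (2 / (1 - q) * x ^ 2) := by
        rw [norm_mul, norm_mul]; gcongr
    _ = A * (2 / (1 - q)) / (N * (2 * a)) ^ (m + 4) * (1 / x ^ 2) := by
        rw [mul_pow]; field_simp; ring
    _ ≤ _ := by gcongr

lemma norm_bigExp_ofReal_le {q : ℝ} (hq0 : 0 < q) (hq1 : q < 1) {w : ℂ} (hw : 1 / 2 ≤ ‖w‖)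
    (hre : |w.re| = ‖w‖) :
    ‖bigExp q w‖ ≤ 9 / (1 - q) * ‖w‖ ^ 2 * ‖bigExp q w - bigExp q (-w)‖ := by
  have hq' : 0 < 1 - q := by linarith
  have hw0 : 0 < ‖w‖ := by linarith
  refine (norm_bigExp_le_sector hq0 hq1 one_pos (norm_pos_iff.1 hw0)
    (by rw [hre, one_mul])).trans ?_
  refine mul_le_mul_of_nonneg_right ?_ (norm_nonneg _)
  rw [div_mul_eq_mul_div, div_le_div_iff₀ (by positivity) (by positivity)]
  have : (1 + ‖w‖) ^ 2 ≤ (3 * ‖w‖) ^ 2 := by gcongr; linarith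
  have h2 : (1 + ‖w‖) ^ 2 ≤ 9 * ‖w‖ ^ 2 * (2 * ‖w‖) := by
    nlinarith [sq_nonneg ‖w‖]
  nlinarith [mul_le_mul_of_nonneg_right h2 hq'.le]

lemma tendsto_pole {q a : ℝ} (hq0 : 0 < q) (hq1 : q < 1) (ha : 0 < a) :
    Tendsto (pole q a) atTop atTop := by
  have h := (tendsto_pow_atTop_atTop_of_one_lt ((one_lt_inv₀ hq0).2 hq1)).atTop_div_const
    (mul_pos ha (by linarith : 0 < 1 - q))
  exact h.congr fun k => by rw [pole, inv_pow]

lemma summable_poleTerm {q a : ℝ} (hq0 : 0 < q) (hq1 : q < 1) (ha : 0 < a) (s : ℂ) :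
    Summable fun k : ℕ => poleTerm q a s k := by
  have hq' : 0 < 1 - q := by linarith
  obtain ⟨G, hG0, hG⟩ := exists_le_prod_one_sub_pow hq0 hq1
  set m := ⌈|s.re|⌉₊ with hm
  set A := Real.exp (Real.pi * |s.im|) with hA
  have hA0 : 0 < A := Real.exp_pos _
  set b := a * (1 - q) with hb
  have hb0 : 0 < b := mul_pos ha hq'
  have hs : Summable fun k : ℕ => 1 / G * A * (18 / (1 - q)) * (1 / b) ^ (m + 2) * q ^ k :=
    (summable_geometric_of_lt_one hq0.le hq1).mul_left _
  refine Summable.of_norm_bounded_eventually_nat hs ?_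
  filter_upwards [(tendsto_pole hq0 hq1 ha).eventually_ge_atTop 1, eventually_ge_atTop (2 * (m + 3))] with k hk1 hk2
  set z := pole q a k with hz
  have hz0 : 0 < z := by linarith
  have hqF : G ≤ ‖qFin q q k‖ := by
    refine (hG k).trans (le_of_eq ?_)
    rw [qFin, norm_prod]
    refine Finset.prod_congr rfl fun j _ => ?_
    have h1 := pow_lt_one₀ hq0.le hq1 (n := j + 1) (by omega)
    rw [← pow_succ', show (1 - (q : ℂ) ^ (j + 1)) = ((1 - q ^ (j + 1) : ℝ) : ℂ) by push_cast; rfl,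
      norm_real, Real.norm_of_nonneg (by linarith)]
  have h1 : ‖(z : ℂ) ^ s‖ ≤ A * z ^ m := by
    have hn : ‖(z : ℂ)‖ = z := by rw [norm_real, Real.norm_of_nonneg hz0.le]
    have := norm_cpow_le_pow s (w := (z : ℂ)) (by rw [hn]; exact hk1)
    rwa [hn] at this
  have h2 : ‖bigExp q (-((z : ℂ) / 2)) / qSinh q ((z : ℂ) / 2)‖ ≤ 18 / (1 - q) * z ^ 2 := by
    have hw : ‖-((z : ℂ) / 2)‖ = z / 2 := by
      rw [norm_neg, norm_div, norm_real, Real.norm_of_nonneg hz0.le]; simp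
    have := norm_bigExp_ofReal_le hq0 hq1 (w := -((z : ℂ) / 2)) (by rw [hw]; linarith) (by
      rw [hw, neg_re, abs_neg, show (z : ℂ) / 2 = ((z / 2 : ℝ) : ℂ) by push_cast; ring, ofReal_re,
        abs_of_pos (by linarith)])
    rw [neg_neg, norm_sub_rev, hw] at this
    rw [norm_div, qSinh, norm_div]
    simp only [norm_ofNat]
    refine div_le_of_le_mul₀ (by positivity) (by positivity) (this.trans ?_)
    have h9 : 9 / (1 - q) * (z / 2) ^ 2 ≤ 18 / (1 - q) * z ^ 2 * (1 / 2) := by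
      have : 0 < 9 / (1 - q) * z ^ 2 := by positivity
      ring_nf at this ⊢
      nlinarith
    calc _ ≤ 18 / (1 - q) * z ^ 2 * (1 / 2) *
        ‖bigExp q ((z : ℂ) / 2) - bigExp q (-((z : ℂ) / 2))‖ := by gcongr
      _ = _ := by ring
  have h3 : ‖(-1 : ℂ) ^ k * (q : ℂ) ^ (k * (k + 1) / 2) / qFin q q k‖
      ≤ q ^ (k * (k + 1) / 2) / G := by
    rw [norm_div, norm_mul, norm_pow, norm_neg, norm_one, one_pow, one_mul, norm_pow, norm_real,
      Real.norm_of_nonneg hq0.le]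
    gcongr
  have hexp : k * (m + 3) ≤ k * (k + 1) / 2 := by
    rw [Nat.le_div_iff_mul_le two_pos, mul_assoc]
    exact Nat.mul_le_mul_left k (by omega)
  have h4 : q ^ (k * (k + 1) / 2) ≤ q ^ k * (q ^ k) ^ (m + 2) := by
    refine (pow_le_pow_of_le_one hq0.le hq1.le hexp).trans (le_of_eq ?_)
    rw [← pow_mul, ← pow_add]; congr 1; ring
  have hzb : q ^ k * z = 1 / b := by
    rw [hz, pole, ← hb]; field_simp
  rw [poleTerm, norm_mul, norm_mul]
  calc _ ≤ q ^ (k * (k + 1) / 2) / G * (A * z ^ m) * (18 / (1 - q) * z ^ 2) := by gcongr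
    _ ≤ q ^ k * (q ^ k) ^ (m + 2) / G * (A * z ^ m) * (18 / (1 - q) * z ^ 2) := by gcongr
    _ = 1 / G * A * (18 / (1 - q)) * (q ^ k * z) ^ (m + 2) * q ^ k := by ring
    _ = _ := by rw [hzb]

lemma norm_stripKern_le {q a : ℝ} {s ζ : ℂ} {A B L : ℝ} (hA : ‖exp (s * ζ)‖ ≤ A)
    (hB0 : 0 ≤ B) (hB : ‖bigExp q (-(exp ζ / 2))‖ ≤
      B * ‖bigExp q (exp ζ / 2) - bigExp q (-(exp ζ / 2))‖)
    (hL0 : 0 < L) (hL : L ≤ ‖bigExp q (-(a * exp ζ))‖) :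
    ‖stripKern q a s ζ‖ ≤ A * B / L := by
  have hA0 : 0 ≤ A := (norm_nonneg _).trans hA
  rw [stripKern, kernDen, norm_div, norm_mul, norm_mul]
  rcases eq_or_lt_of_le (norm_nonneg (bigExp q (exp ζ / 2) - bigExp q (-(exp ζ / 2)))) with h | h
  · rw [← h, mul_zero, div_zero]; positivity
  · rw [div_le_div_iff₀ (mul_pos (hL0.trans_le hL) h) hL0]
    calc _ ≤ A * (B * ‖bigExp q (exp ζ / 2) - bigExp q (-(exp ζ / 2))‖) *
        ‖bigExp q (-(a * exp ζ))‖ := by gcongr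
      _ = _ := by ring

lemma exp_log_add_pi {r θ : ℝ} (hr : 0 < r) (hθ : θ = Real.pi ∨ θ = -Real.pi) :
    exp (Real.log r + θ * I) = -r := by
  rw [exp_add, ← ofReal_exp, Real.exp_log hr]
  rcases hθ with rfl | rfl
  · rw [exp_pi_mul_I]; ring
  · push_cast
    rw [neg_mul, exp_neg, exp_pi_mul_I]; norm_num

/-- Decay of the integrand on the edges of the cut. -/
lemma norm_stripKern_edge_le {q a : ℝ} (hq0 : 0 < q) (hq1 : q < 1) (ha : 0 < a) (s : ℂ) {θ : ℝ}
    (hθ : θ = Real.pi ∨ θ = -Real.pi) :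
    ∃ C, ∀ r : ℝ, 1 ≤ r → ‖stripKern q a s (Real.log r + θ * I)‖ ≤ C / r := by
  have hq' : 0 < 1 - q := by linarith
  set m := ⌈|s.re|⌉₊ with hm
  set A := Real.exp (Real.pi * |s.im|) with hA
  set N := node q (m + 3) with hN
  have hN0 : 0 < N := node_pos hq0 hq1 _
  refine ⟨A * (9 / (4 * (1 - q))) / (N * a) ^ (m + 3), fun r hr => ?_⟩
  have hr0 : 0 < r := by linarith
  have hz := exp_log_add_pi hr0 hθ
  have hre : (Real.log r + θ * I : ℂ).re = Real.log r := by simp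
  have him : (Real.log r + θ * I : ℂ).im = θ := by simp
  have h1 := norm_exp_mul_le s (ζ := Real.log r + θ * I) (by rw [hre]; exact Real.log_nonneg hr)
    (by rw [him]; rcases hθ with rfl | rfl <;> simp [abs_of_pos Real.pi_pos])
  rw [hre, Real.exp_log hr0] at h1
  have hw : ‖(r : ℂ) / 2‖ = r / 2 := by
    rw [norm_div, norm_real, Real.norm_of_nonneg hr0.le]; simp
  have h2 := norm_bigExp_ofReal_le hq0 hq1 (w := (r : ℂ) / 2) (by rw [hw]; linarith) (by
      rw [hw, show (r : ℂ) / 2 = ((r / 2 : ℝ) : ℂ) by push_cast; ring, ofReal_re,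
        abs_of_pos (by linarith)])
  have h3 := pow_le_norm_bigExp hq0 hq1 (m + 3) (z := (a : ℂ) * r) (by simp; positivity)
  rw [norm_mul, norm_real, norm_real, Real.norm_of_nonneg ha.le, Real.norm_of_nonneg hr0.le] at h3
  refine (norm_stripKern_le (B := 9 / (1 - q) * (r / 2) ^ 2) (L := (N * (a * r)) ^ (m + 3)) h1
    (by positivity) ?_ (by positivity) ?_).trans (le_of_eq ?_)
  · rw [hz, neg_div, neg_neg, norm_sub_rev, ← hw]; exact h2
  · rw [hz, mul_neg, neg_neg]; exact h3
  · rw [← mul_assoc N, mul_pow (N * a)]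
    field_simp
    ring

/-- The radii of the circles on which the kernel is estimated. -/
def IsGoodRadius (q a R : ℝ) : Prop :=
  (∀ w : ℂ, ‖w‖ = R / 2 →
    ‖bigExp q w‖ ≤ 96 / (1 - q) ^ 2 * (1 + ‖w‖) ^ 2 * ‖bigExp q w - bigExp q (-w)‖) ∧
  ∀ k : ℕ, (1 - q) / 400 ≤ |1 - a * (1 - q) * R * q ^ k|

lemma exists_isGoodRadius {q : ℝ} (hq0 : 0 < q) (hq1 : q < 1) (a : ℝ) (n : ℕ) :
    ∃ R : ℝ, n + 1 ≤ R ∧ IsGoodRadius q a R := by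
  have hq' : 0 < 1 - q := by linarith
  have hpi := Real.pi_gt_three
  set y := phaseInv q (n * Real.pi + Real.pi / 2) with hy
  have hyn : n * Real.pi + Real.pi / 2 ≤ y := le_phaseInv hq0 hq1 (by positivity)
  have hn0 : (0 : ℝ) ≤ n := Nat.cast_nonneg n
  have hy1 : n + 1 ≤ y := by nlinarith
  have hE := bigExp_add_eq_zero_phaseInv hq0 hq1 n
  rcases abs_one_sub_or hq0 hq1 (a * (1 - q) * (2 * y)) with h | h
  · refine ⟨2 * y, by linarith, fun w hw => ?_, h⟩
    exact norm_bigExp_le_on_circle hq0 hq1 (by linarith) hE (by rw [hw]; linarith)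
      (by rw [hw]; nlinarith)
  · refine ⟨(1 + (1 - q) / 96) * (2 * y), by nlinarith, fun w hw => ?_, fun k => ?_⟩
    · exact norm_bigExp_le_on_circle hq0 hq1 (by linarith) hE (by rw [hw]; nlinarith)
        (by rw [hw]; nlinarith)
    · convert h k using 3; ring

lemma IsGoodRadius.kernDen_ne_zero {q a R : ℝ} (hq0 : 0 < q) (hq1 : q < 1) (ha : 0 < a)
    (hR : IsGoodRadius q a R) (hR0 : 0 < R) {z : ℂ} (hz : ‖z‖ = R) : kernDen q a z ≠ 0 := by
  have hz0 : z ≠ 0 := norm_pos_iff.1 (by rw [hz]; exact hR0)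
  intro h
  obtain ⟨i, rfl⟩ := exists_sing_of_kernDen_eq_zero hq0 hq1 ha hz0 h
  rcases mul_eq_zero.1 h with h1 | h1
  · obtain ⟨k, hk⟩ := (bigExp_eq_zero_iff hq0 hq1 _).1 h1
    have h2 : (node q k : ℂ) * (a * sing q a i) = 1 := by linear_combination -hk
    have h3 := congrArg norm h2
    rw [norm_mul, norm_mul, hz, norm_one, norm_real, norm_real,
      Real.norm_of_nonneg (node_pos hq0 hq1 k).le, Real.norm_of_nonneg ha.le, node] at h3
    have h4 := hR.2 k
    rw [show a * (1 - q) * R * q ^ k = (1 - q) * q ^ k * (a * R) by ring, h3, sub_self,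
      abs_zero] at h4
    linarith
  · have hn : ‖sing q a i / 2‖ = R / 2 := by rw [norm_div, hz]; simp
    have h2 := hR.1 _ hn
    have h3 := hR.1 (-(sing q a i / 2)) (by rw [norm_neg, hn])
    rw [h1, norm_zero, mul_zero, norm_le_zero_iff] at h2
    rw [neg_neg, norm_sub_rev, h1, norm_zero, mul_zero, norm_le_zero_iff] at h3
    rcases le_total 0 (sing q a i / 2).re with h4 | h4
    · exact bigExp_ne_zero_of_re_nonneg hq0 hq1 h4 h2
    · exact bigExp_ne_zero_of_re_nonneg hq0 hq1 (z := -(sing q a i / 2)) (by simpa using h4) h3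

/-- Decay of the integrand on circles of good radius. -/
lemma norm_stripKern_circle_le {q a : ℝ} (hq0 : 0 < q) (hq1 : q < 1) (ha : 0 < a) (s : ℂ) :
    ∃ C R₀, ∀ R : ℝ, R₀ ≤ R → IsGoodRadius q a R → ∀ y : ℝ, |y| ≤ Real.pi →
      ‖stripKern q a s (Real.log R + y * I)‖ ≤ C / R := by
  have hq' : 0 < 1 - q := by linarith
  obtain ⟨G, hG0, hG⟩ := exists_le_prod_one_sub_pow hq0 hq1
  set m := ⌈|s.re|⌉₊ with hm
  set A := Real.exp (Real.pi * |s.im|) with hA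
  set b := a * (1 - q) with hb
  have hb0 : 0 < b := mul_pos ha hq'
  set δ := (1 - q) / 400 with hδ
  have hδ0 : 0 < δ := by positivity
  refine ⟨A * (96 / (1 - q) ^ 2 * 4) / ((b * q ^ (m + 3)) ^ (m + 3) * G * (δ * δ) * G),
    1 / (b * q ^ (m + 3)) + 1, fun R hRR hgood y hy => ?_⟩
  have hbq : 0 < b * q ^ (m + 3) := by positivity
  have hR1 : 1 ≤ R := by
    have : 0 < 1 / (b * q ^ (m + 3)) := by positivity
    linarith
  have hR0 : 0 < R := by linarith
  have hx : 1 ≤ b * R * q ^ (m + 3) := by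
    have : 1 / (b * q ^ (m + 3)) ≤ R := by linarith
    rw [div_le_iff₀ hbq] at this
    nlinarith
  have hre : (Real.log R + y * I : ℂ).re = Real.log R := by simp
  have him : (Real.log R + y * I : ℂ).im = y := by simp
  have h1 := norm_exp_mul_le s (ζ := Real.log R + y * I) (by rw [hre]; exact Real.log_nonneg hR1)
    (by rw [him]; exact hy)
  rw [hre, Real.exp_log hR0] at h1
  have hzn : ‖exp (Real.log R + y * I)‖ = R := by rw [norm_exp, hre, Real.exp_log hR0]
  set z := exp (Real.log R + y * I) with hz
  have hw : ‖-(z / 2)‖ = R / 2 := by rw [norm_neg, norm_div, hzn]; simp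
  have h2 := hgood.1 _ hw
  rw [neg_neg, norm_sub_rev, hw] at h2
  have h3 := le_norm_bigExp_neg hq0 hq1 hG0 hG hδ0.le hx hgood.2 (w := (a : ℂ) * z) (by
    rw [norm_mul, hzn, norm_real, Real.norm_of_nonneg ha.le, hb]; ring)
  have hC0 : 0 < (b * R * q ^ (m + 3)) ^ (m + 3) * G * (δ * δ) * G := by positivity
  refine (norm_stripKern_le h1 (by positivity) h2 hC0 h3).trans ?_
  have hsq : (1 + R / 2) ^ 2 ≤ 4 * R ^ 2 := by nlinarith
  calc _ ≤ A * R ^ m * (96 / (1 - q) ^ 2 * (4 * R ^ 2)) /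
        ((b * R * q ^ (m + 3)) ^ (m + 3) * G * (δ * δ) * G) := by gcongr
    _ = _ := by
      rw [show b * R * q ^ (m + 3) = b * q ^ (m + 3) * R by ring, mul_pow (b * q ^ (m + 3)) R]
      field_simp
      ring

/-! ### The loop integral as a limit of rectangle integrals -/

lemma continuous_stripKern_edge {q a : ℝ} (hq0 : 0 < q) (hq1 : q < 1) (ha : 0 < a) (s : ℂ) {θ : ℝ}
    (hθ : θ = Real.pi ∨ θ = -Real.pi) :
    Continuous fun x : ℝ => stripKern q a s (x + θ * I) := by
  rw [continuous_iff_continuousAt]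
  intro x
  have he : exp ((x : ℂ) + θ * I) = -(Real.exp x : ℝ) := by
    have := exp_log_add_pi (Real.exp_pos x) hθ
    rwa [Real.log_exp] at this
  have hne : kernDen q a (exp (x + θ * I)) ≠ 0 := by
    intro h
    obtain ⟨i, hi⟩ := exists_sing_of_kernDen_eq_zero hq0 hq1 ha (exp_ne_zero _) h
    have hs := sing_mem_slitPlane hq0 hq1 ha i
    rw [← hi, he, mem_slitPlane_iff] at hs
    simp only [neg_re, neg_im, ofReal_re, ofReal_im, neg_zero, ne_eq, not_true, or_false] at hs
    linarith [Real.exp_pos x]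
  exact ContinuousAt.comp (g := stripKern q a s) (f := fun x : ℝ => (x : ℂ) + θ * I)
    (differentiableAt_stripKern hq0 hq1 hne).continuousAt (by fun_prop)

lemma lt_norm_sing {q a c : ℝ} (hq0 : 0 < q) (hq1 : q < 1) (ha : 0 < a)
    (hc1 : c < 2 * xi q 1) (hc2 : c < 1 / (a * (1 - q))) (i : (ℕ ⊕ ℕ) ⊕ ℕ) :
    c < ‖sing q a i‖ := by
  have hxi : ∀ k, xi q 1 ≤ xi q (k + 1) := fun k =>
    (strictMono_xi hq0 hq1).monotone (by omega)
  rcases i with (k | k) | k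
  · rw [(norm_sing_zero hq0 hq1 k).1]; linarith [hxi k]
  · rw [(norm_sing_zero hq0 hq1 k).2]; linarith [hxi k]
  · rw [norm_sing_pole hq0 hq1 ha]
    refine hc2.trans_le ?_
    have : 0 < 1 - q := by linarith
    rw [pole]
    gcongr
    exact (one_le_inv₀ (pow_pos hq0 k)).2 (pow_le_one₀ hq0.le hq1.le)

lemma finite_norm_sing_lt {q a : ℝ} (hq0 : 0 < q) (hq1 : q < 1) (ha : 0 < a) (R : ℝ) :
    {i | ‖sing q a i‖ < R}.Finite := by
  obtain ⟨K₁, hK₁⟩ := eventually_atTop.1 ((tendsto_pole hq0 hq1 ha).eventually_ge_atTop R)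
  obtain ⟨K₂, hK₂⟩ := exists_nat_ge R
  set K := max K₁ K₂
  refine ((((Finset.range K).disjSum (Finset.range K)).disjSum
    (Finset.range K)).finite_toSet).subset ?_
  have hz : ∀ k, 2 * xi q (k + 1) < R → k < K := by
    intro k hk
    by_contra! h
    have h1 := le_xi hq0 hq1 (k + 1)
    have h2 : (K₂ : ℝ) ≤ k := by exact_mod_cast (le_max_right _ _).trans h
    push_cast at h1
    linarith [(Nat.cast_nonneg k : (0 : ℝ) ≤ k)]
  rintro ((k | k) | k) hk
  · rw [Set.mem_ofPred_eq, (norm_sing_zero hq0 hq1 k).1] at hk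
    simpa using hz k hk
  · rw [Set.mem_ofPred_eq, (norm_sing_zero hq0 hq1 k).2] at hk
    simpa using hz k hk
  · rw [Set.mem_ofPred_eq, norm_sing_pole hq0 hq1 ha] at hk
    have : k < K := by
      by_contra! h
      linarith [hK₁ k ((le_max_left _ _).trans h)]
    simpa using this

lemma integral_log_edge {G : ℝ → ℂ} (hG : Continuous G) {c R : ℝ} (hc : 0 < c) (hcR : c ≤ R) :
    ∫ x in Real.log c..Real.log R, G x = ∫ r in c..R, G (Real.log r) / r := by
  have hne : ∀ x ∈ Set.uIcc c R, x ≠ 0 := fun x hx => by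
    rw [Set.uIcc_of_le hcR] at hx
    exact (hc.trans_le hx.1).ne'
  rw [← intervalIntegral.integral_deriv_smul_comp (f := Real.log) (f' := fun x => x⁻¹)
    (fun x hx => Real.hasDerivAt_log (hne x hx)) (continuousOn_id.inv₀ hne) hG]
  refine intervalIntegral.integral_congr fun x _ => ?_
  simp only [Function.comp, real_smul, ofReal_inv]
  ring

open MeasureTheory in
lemma integrableOn_edge {q a c : ℝ} (hq0 : 0 < q) (hq1 : q < 1) (ha : 0 < a) (s : ℂ) (hc : 0 < c)
    {θ : ℝ} (hθ : θ = Real.pi ∨ θ = -Real.pi) :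
    IntegrableOn (fun r : ℝ => stripKern q a s (Real.log r + θ * I) / r) (Set.Ioi c) := by
  obtain ⟨C, hC⟩ := norm_stripKern_edge_le hq0 hq1 ha s hθ
  refine IntegrableOn.mono_set ?_ Set.Ioi_subset_Ici_self
  refine LocallyIntegrableOn.integrableOn_of_isBigO_atTop (g := fun r : ℝ => r ^ (-2 : ℝ)) ?_ ?_
    (integrableAtFilter_rpow_atTop_iff.2 (by norm_num))
  · refine ContinuousOn.locallyIntegrableOn ?_ measurableSet_Ici
    have hne : ∀ r ∈ Set.Ici c, r ≠ 0 := fun r hr => (hc.trans_le hr).ne'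
    refine ContinuousOn.div ?_ continuous_ofReal.continuousOn fun r hr => by
      exact_mod_cast hne r hr
    exact (continuous_stripKern_edge hq0 hq1 ha s hθ).comp_continuousOn
      (Real.continuousOn_log.mono fun r hr => hne r hr)
  · refine Asymptotics.IsBigO.of_bound C ?_
    filter_upwards [eventually_ge_atTop 1] with r hr
    have hr0 : 0 < r := by linarith
    rw [norm_div, norm_real, Real.norm_of_nonneg hr0.le, Real.norm_of_nonneg (by positivity),
      Real.rpow_neg hr0.le, Real.rpow_two, div_le_iff₀ hr0]
    refine (hC r hr).trans (le_of_eq ?_)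
    field_simp

lemma integrand_edge {q a : ℝ} (hq0 : 0 < q) (hq1 : q < 1) (s : ℂ) {θ : ℝ}
    (hθ : θ = Real.pi ∨ θ = -Real.pi) {r : ℝ} (hr : 0 < r) :
    integrand q a s r θ * exp (θ * I) = stripKern q a s (Real.log r + θ * I) / r := by
  have hr' : (r : ℂ) ≠ 0 := by exact_mod_cast hr.ne'
  have hp : polar r θ = -r := by rw [polar_eq_exp hr, exp_log_add_pi hr hθ]
  rw [← integrand_mul_polar hr, polar]
  · field_simp
  · rw [hp]
    refine bigExp_ne_zero_of_re_nonneg hq0 hq1 ?_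
    rw [neg_div, neg_neg, show (r : ℂ) / 2 = ((r / 2 : ℝ) : ℂ) by push_cast; ring, ofReal_re]
    positivity

lemma bigExp_polar_ne_zero {q : ℝ} (hq0 : 0 < q) (hq1 : q < 1) {r θ : ℝ} (hr : 0 < r)
    (hθ : |θ| ≤ Real.pi) (hθ0 : θ ≠ 0) : bigExp q (-(polar r θ / 2)) ≠ 0 := by
  rw [Ne, bigExp_eq_zero_iff hq0 hq1]
  rintro ⟨k, hk⟩
  have hn := node_pos hq0 hq1 k
  have h1 : ((node q k * r / 2 : ℝ) : ℂ) * exp (θ * I) = 1 := by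
    rw [polar] at hk
    push_cast
    linear_combination -hk
  have hpos : 0 < node q k * r / 2 := by positivity
  have hre := congrArg re h1
  have him := congrArg im h1
  rw [re_ofReal_mul, exp_ofReal_mul_I_re, one_re] at hre
  rw [im_ofReal_mul, exp_ofReal_mul_I_im, one_im, mul_eq_zero, or_iff_right hpos.ne'] at him
  have hcos : 0 < Real.cos θ := by
    by_contra! h
    nlinarith
  rcases eq_or_lt_of_le (abs_le.1 hθ).1 with h | h
  · rw [← h, Real.cos_neg, Real.cos_pi] at hcos; linarith
  rcases eq_or_lt_of_le (abs_le.1 hθ).2 with h2 | h2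
  · rw [h2, Real.cos_pi] at hcos; linarith
  · exact hθ0 ((Real.sin_eq_zero_iff_of_lt_of_lt h h2).1 him)

open MeasureTheory in
lemma integrand_circle_ae {q a c : ℝ} (hq0 : 0 < q) (hq1 : q < 1) (s : ℂ) (hc : 0 < c) :
    ∀ᵐ θ : ℝ, θ ∈ Set.uIoc Real.pi (-Real.pi) →
      integrand q a s c θ * (I * polar c θ) = I * stripKern q a s (Real.log c + θ * I) := by
  filter_upwards [volume.ae_ne 0] with θ hθ hmem
  rw [Set.uIoc_comm, Set.uIoc_of_le neg_pi_le_pi] at hmem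
  rw [← integrand_mul_polar hc
    (bigExp_polar_ne_zero hq0 hq1 hc (abs_le.2 ⟨hmem.1.le, hmem.2⟩) hθ)]
  ring

lemma continuous_stripKern_circle {q a c : ℝ} (hq0 : 0 < q) (hq1 : q < 1) (ha : 0 < a) (s : ℂ)
    (hc : 0 < c) (hc1 : c < 2 * xi q 1) (hc2 : c < 1 / (a * (1 - q))) :
    Continuous fun θ : ℝ => stripKern q a s (Real.log c + θ * I) := by
  rw [continuous_iff_continuousAt]
  intro θ
  have hn : ‖exp ((Real.log c : ℂ) + θ * I)‖ = c := by
    rw [norm_exp]; simp [Real.exp_log hc]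
  have hne : kernDen q a (exp (Real.log c + θ * I)) ≠ 0 := by
    intro h
    obtain ⟨i, hi⟩ := exists_sing_of_kernDen_eq_zero hq0 hq1 ha (exp_ne_zero _) h
    have := lt_norm_sing hq0 hq1 ha hc1 hc2 i
    rw [← hi, hn] at this
    exact lt_irrefl _ this
  exact ContinuousAt.comp (g := stripKern q a s) (f := fun θ : ℝ => (Real.log c : ℂ) + θ * I)
    (differentiableAt_stripKern hq0 hq1 hne).continuousAt (by fun_prop)

open MeasureTheory in
lemma loopIntegrable_integrand {q a c : ℝ} (hq0 : 0 < q) (hq1 : q < 1) (ha : 0 < a) (s : ℂ)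
    (hc : 0 < c) (hc1 : c < 2 * xi q 1) (hc2 : c < 1 / (a * (1 - q))) :
    LoopIntegrable c (integrand q a s) := by
  refine ⟨?_, ?_, ?_⟩
  · refine (integrableOn_edge hq0 hq1 ha s hc (.inl rfl)).congr_fun (fun r hr => ?_)
      measurableSet_Ioi
    exact (integrand_edge hq0 hq1 s (.inl rfl) (hc.trans hr)).symm
  · have h := ((continuous_stripKern_circle hq0 hq1 ha s hc hc1 hc2).const_mul
      I).intervalIntegrable (μ := volume) Real.pi (-Real.pi)
    refine h.congr_ae ((ae_restrict_iff' measurableSet_uIoc).2 ?_)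
    filter_upwards [integrand_circle_ae (a := a) hq0 hq1 s hc] with θ hθ hmem using (hθ hmem).symm
  · refine (integrableOn_edge hq0 hq1 ha s hc (.inr rfl)).congr_fun (fun r hr => ?_)
      measurableSet_Ioi
    have := integrand_edge (a := a) hq0 hq1 s (.inr rfl) (hc.trans hr)
    dsimp only
    rw [← this]; push_cast; rfl

open MeasureTheory in
lemma loopIntegral_integrand {q a c : ℝ} (hq0 : 0 < q) (hq1 : q < 1) (s : ℂ) (hc : 0 < c) :
    loopIntegral c (integrand q a s) =
      (∫ r in Set.Ioi c, stripKern q a s (Real.log r + (-Real.pi : ℝ) * I) / r)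
      - (∫ r in Set.Ioi c, stripKern q a s (Real.log r + (Real.pi : ℝ) * I) / r)
      - I * ∫ θ in (-Real.pi)..Real.pi, stripKern q a s (Real.log c + θ * I) := by
  have hlow : ∫ r in Set.Ioi c, integrand q a s r (-Real.pi) * exp (-(Real.pi : ℂ) * I)
      = ∫ r in Set.Ioi c, stripKern q a s (Real.log r + (-Real.pi : ℝ) * I) / r := by
    refine setIntegral_congr_fun measurableSet_Ioi fun r hr => ?_
    have := integrand_edge (a := a) hq0 hq1 s (.inr rfl) (hc.trans hr)
    rw [← this]; push_cast; rfl
  rw [loopIntegral, intervalIntegral.integral_congr_ae (integrand_circle_ae hq0 hq1 s hc),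
    intervalIntegral.integral_const_mul, intervalIntegral.integral_symm (-Real.pi),
    setIntegral_congr_fun measurableSet_Ioi
      (fun r hr => integrand_edge hq0 hq1 s (.inl rfl) (hc.trans hr)), hlow]
  ring

open MeasureTheory in
lemma tendsto_stripBoundary {q a c : ℝ} (hq0 : 0 < q) (hq1 : q < 1) (ha : 0 < a) (s : ℂ)
    (hc : 0 < c) {R : ℕ → ℝ} (hR : Tendsto R atTop atTop) (hgood : ∀ n, IsGoodRadius q a (R n)) :
    Tendsto (fun n => stripBoundary (stripKern q a s) (Real.log c) (Real.log (R n))) atTop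
      (𝓝 (loopIntegral c (integrand q a s))) := by
  have hedge : ∀ θ : ℝ, (θ = Real.pi ∨ θ = -Real.pi) →
      Tendsto (fun n => ∫ x in Real.log c..Real.log (R n), stripKern q a s (x + θ * I)) atTop
        (𝓝 (∫ r in Set.Ioi c, stripKern q a s (Real.log r + θ * I) / r)) := by
    intro θ hθ
    refine (intervalIntegral_tendsto_integral_Ioi c
      (integrableOn_edge hq0 hq1 ha s hc hθ) hR).congr' ?_
    filter_upwards [hR.eventually_ge_atTop c] with n hn
    exact (integral_log_edge (continuous_stripKern_edge hq0 hq1 ha s hθ) hc hn).symm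
  have hcirc : Tendsto (fun n => I * ∫ y in (-Real.pi)..Real.pi,
      stripKern q a s (Real.log (R n) + y * I)) atTop (𝓝 0) := by
    obtain ⟨C, R₀, hC⟩ := norm_stripKern_circle_le hq0 hq1 ha s
    have h0 : Tendsto (fun n => C / R n * |Real.pi - -Real.pi|) atTop (𝓝 0) := by
      have := (hR.const_div_atTop C).mul_const |Real.pi - -Real.pi|
      rwa [zero_mul] at this
    refine squeeze_zero_norm' ?_ h0
    filter_upwards [hR.eventually_ge_atTop R₀] with n hn
    rw [norm_mul, norm_I, one_mul]
    refine intervalIntegral.norm_integral_le_of_norm_le_const fun y hy => ?_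
    rw [Set.uIoc_of_le neg_pi_le_pi] at hy
    exact hC (R n) hn (hgood n) y (abs_le.2 ⟨hy.1.le, hy.2⟩)
  rw [loopIntegral_integrand hq0 hq1 s hc]
  have h := (((hedge _ (.inr rfl)).sub (hedge _ (.inl rfl))).add hcirc).sub_const
    (I * ∫ θ in (-Real.pi)..Real.pi, stripKern q a s (Real.log c + θ * I))
  rw [add_zero] at h
  exact h

lemma hasSum_singRes {q a : ℝ} (hq0 : 0 < q) (hq1 : q < 1) (ha : 0 < a) (s : ℂ) :
    HasSum (singRes q a s) ((2 : ℂ) ^ (s - 1) * ∑' k : ℕ, (zeroTerm q a s I (k + 1)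
      + zeroTerm q a s (-I) (k + 1)) - 1 / (2 * qInf q q) * ∑' k : ℕ, poleTerm q a s k) := by
  have h1 := summable_zeroTerm hq0 hq1 ha s (.inl rfl)
  have h2 := summable_zeroTerm hq0 hq1 ha s (.inr rfl)
  have h3 := summable_poleTerm hq0 hq1 ha s
  rw [h1.tsum_add h2, mul_add, sub_eq_add_neg, ← neg_mul]
  exact ((h1.hasSum.mul_left _).sum (f := fun i => singRes q a s (.inl i))
    (h2.hasSum.mul_left _)).sum (h3.hasSum.mul_left _)

lemma stripBoundary_stripKern {q a c R : ℝ} (hq0 : 0 < q) (hq1 : q < 1) (ha : 0 < a) (s : ℂ)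
    (hc : 0 < c) (hc1 : c < 2 * xi q 1) (hc2 : c < 1 / (a * (1 - q))) (hcR : c ≤ R)
    (hR : IsGoodRadius q a R) :
    stripBoundary (stripKern q a s) (Real.log c) (Real.log R)
      = 2 * Real.pi * I * ∑ i ∈ (finite_norm_sing_lt hq0 hq1 ha R).toFinset, singRes q a s i := by
  have hR0 : 0 < R := hc.trans_le hcR
  refine stripBoundary_eq_sum_residues _ (w := sing q a) (Real.log_le_log hc hcR)
    (sing_injective hq0 hq1 ha).injOn (fun i _ => sing_mem_slitPlane hq0 hq1 ha i) ?_ ?_ ?_ ?_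
  · intro i _
    rw [Real.exp_log hc]; exact lt_norm_sing hq0 hq1 ha hc1 hc2 i
  · intro i hi
    rw [Real.exp_log hR0]; simpa using hi
  · intro ζ hζ hne
    refine differentiableAt_stripKern hq0 hq1 fun h => ?_
    obtain ⟨i, hi⟩ := exists_sing_of_kernDen_eq_zero hq0 hq1 ha (exp_ne_zero _) h
    have hle : ‖exp ζ‖ ≤ R := by
      rw [norm_exp, ← Real.exp_log hR0]; exact Real.exp_le_exp.2 hζ.1.2
    rcases hle.lt_or_eq with h1 | h1
    · exact hne i (by simpa [hi] using h1) hi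
    · exact hR.kernDen_ne_zero hq0 hq1 ha hR0 h1 h
  · rintro ((k | k) | k) _
    · exact tendsto_stripKern_zero hq0 hq1 s (.inl rfl) k
    · exact tendsto_stripKern_zero hq0 hq1 s (.inr rfl) k
    · exact tendsto_stripKern_pole hq0 hq1 ha s k

lemma loopIntegral_eq {q a c : ℝ} (hq0 : 0 < q) (hq1 : q < 1) (ha : 0 < a) (s : ℂ)
    (hc : 0 < c) (hc1 : c < 2 * xi q 1) (hc2 : c < 1 / (a * (1 - q))) :
    loopIntegral c (integrand q a s) = 2 * Real.pi * I *
      ((2 : ℂ) ^ (s - 1) * ∑' k : ℕ, (zeroTerm q a s I (k + 1)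
        + zeroTerm q a s (-I) (k + 1)) - 1 / (2 * qInf q q) * ∑' k : ℕ, poleTerm q a s k) := by
  choose R hRn hgood using exists_isGoodRadius hq0 hq1 a
  have hR : Tendsto R atTop atTop := by
    refine tendsto_atTop_mono (fun n => ?_) tendsto_natCast_atTop_atTop
    linarith [hRn n]
  have hT : Tendsto (fun n => (finite_norm_sing_lt hq0 hq1 ha (R n)).toFinset) atTop atTop := by
    refine tendsto_atTop.2 fun T => ?_
    have : ∀ᶠ n in atTop, ∀ i ∈ T, ‖sing q a i‖ < R n :=
      (Finset.eventually_all T).2 fun i _ => hR.eventually_gt_atTop _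
    filter_upwards [this] with n hn i hi
    simpa using hn i hi
  refine tendsto_nhds_unique (tendsto_stripBoundary hq0 hq1 ha s hc hR hgood) ?_
  refine (((hasSum_singRes hq0 hq1 ha s).comp hT).const_mul _).congr' ?_
  filter_upwards [hR.eventually_ge_atTop c] with n hn
  exact (stripBoundary_stripKern hq0 hq1 ha s hc hc1 hc2 hn (hgood n)).symm

end QHurwitz

end

theorem mainTheorem5 (q : ℝ) (hq0 : 0 < q) (hq1 : q < 1) (a : ℝ) (ha : 0 < a) (s : ℂ)
    (c : ℝ) (hc : 0 < c) (hc1 : c < 2 * QHurwitz.xi q 1) (hc2 : c < 1 / (a * (1 - q))) :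
    -- the `ξ_k` (`k ≥ 1`) list the positive zeros of `Sin_q` in increasing order; all are simple
    (StrictMono (QHurwitz.xi q)
      ∧ Set.range (fun k : ℕ => QHurwitz.xi q (k + 1)) = QHurwitz.posZeros q
      ∧ ∀ k : ℕ, deriv (QHurwitz.qSin q) (QHurwitz.xi q (k + 1) : ℂ) ≠ 0)
    -- the contour integral and the series converge absolutely
    ∧ QHurwitz.LoopIntegrable c (QHurwitz.integrand q a s)
    ∧ Summable (fun k : ℕ => QHurwitz.zeroTerm q a s Complex.I (k + 1))
    ∧ Summable (fun k : ℕ => QHurwitz.zeroTerm q a s (-Complex.I) (k + 1))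
    ∧ Summable (fun k : ℕ => QHurwitz.poleTerm q a s k)
    -- the series representation
    ∧ QHurwitz.hurwitzH q c s a =
        (2 : ℂ) ^ (s - 1) * ∑' k : ℕ, (QHurwitz.zeroTerm q a s Complex.I (k + 1)
            + QHurwitz.zeroTerm q a s (-Complex.I) (k + 1))
        - 1 / (2 * QHurwitz.qInf q (q : ℂ)) * ∑' k : ℕ, QHurwitz.poleTerm q a s k := by
  refine ⟨⟨QHurwitz.strictMono_xi hq0 hq1, QHurwitz.range_xi hq0 hq1, fun k =>
    QHurwitz.deriv_qSin_ne_zero hq0 hq1 (QHurwitz.qSin_xi hq0 hq1 k)⟩,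
    QHurwitz.loopIntegrable_integrand hq0 hq1 ha s hc hc1 hc2,
    QHurwitz.summable_zeroTerm hq0 hq1 ha s (.inl rfl),
    QHurwitz.summable_zeroTerm hq0 hq1 ha s (.inr rfl),
    QHurwitz.summable_poleTerm hq0 hq1 ha s, ?_⟩
  have hpi : 2 * (Real.pi : ℂ) * Complex.I ≠ 0 := Complex.two_pi_I_ne_zero
  rw [QHurwitz.hurwitzH, QHurwitz.loopIntegral_eq hq0 hq1 ha s hc hc1 hc2, ← mul_assoc,
    one_div_mul_cancel hpi, one_mul]
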